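/- For a positive integer $N$ let $\sigma(N)$ denote the sum of its positive divisors. For all integers $s\ge 0$, $n\ge 1$ and every finite set $S$ of non-negative integers there is a constant $C=C(s,n,S)$, depending only on $s$, $n$ and $S$ and effectively computable from them (that is, $(s,n,S)\mapsto C(s,n,S)$ is a computable function with values in the non-negative integers), such that the following holds. Let $d\ge 1$ and $t\ge 0$ be integers, let $p_1,\dots,p_s,q_1,\dots,q_t$ be pairwise distinct primes, let $\alpha_1,\dots,\alpha_s$ be positive integers, and let $\beta_1,\dots,\beta_t$ be positive integers belonging to $S$. If $$N=p_1^{\alpha_1}\cdots p_s^{\alpha_s}\,q_1^{2\beta_1}\cdots q_t^{2\beta_t}>1\qquad\text{satisfies}\qquad \frac{\sigma(N)}{N}=\frac nd,$$ then $N$ has a prime factor smaller than $C$. -/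

import Mathlib

/-- `h(N) = σ(N) / N`, where `σ(N)` is the sum of the positive divisors of `N`. -/
def abundancyIndex (N : ℕ) : ℚ := (ArithmeticFunction.sigma 1 N : ℚ) / (N : ℚ)

/-- A natural-number-valued quantity `C s n S`, attached to two natural numbers `s`, `n` and a
finite set `S` of natural numbers, is effectively computable: a single algorithm computes it
from `s`, `n` and any list of the elements of `S`. -/
def EffectivelyComputable (C : ℕ → ℕ → Finset ℕ → ℕ) : Prop :=
  Computable fun x : ℕ × ℕ × List ℕ => C x.1 x.2.1 x.2.2.toFinset

/-! Suppose that all prime factors of N are at least C. As σ(N) > N, we have d < n, so n/d is at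
least 1 + 1/(n-1); since σ(N)/N is at most the exponential of twice the sum of reciprocals of the
primes dividing N, that sum is at least 1/(4n) (`inv_le_sum_inv_of_mul_sigma_eq`). The primes p_i
contribute at most s/C. It remains to see that the q_j contribute little.

Fix b in S, let l be the least prime factor of 2b+1, and let L be a multiple of all such l. A prime
r ≡ 1 mod L has a residue g of order l, and if q_j ≡ g mod r with β_j = b, then r divides
σ(q_j^(2b)), hence nN (`exists_excluded_residue`). So r divides n, or is some p_i, or is some q_j ≡
1 mod L. There are at most n of the last kind: each yields a prime factor l ≤ L < C of nN, which
must divide n (`card_modEq_one_le`). Thus for all but 2n+s primes r ≡ 1 mod L, the q_j with β_j = b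
avoid a nonzero class mod r, besides the class 0.

Brun's pure sieve (`card_avoiding_residues_le`) then saves a power of log q over the density of
primes, so the reciprocal sum over such q converges, with an explicit tail
(`exists_sum_inv_le_of_avoiding`). The sieve needs a lower bound of order log log x for the sum of
1/r over r ≡ 1 mod L. A weak constant suffices, and it comes from counting lattice points in the
cyclotomic field: a box of integers of large norm has log norm equal on average to a sum over prime
ideals, and prime ideals of degree one lie over primes r ≡ 1 mod L or r | L
(`exists_log_le_sum_log_div_primes_modEq_one`). -/

open NumberField in
/-- The algebraic integer `b + ∑ cᵢ θⁱ`. -/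
noncomputable def boxElement {K : Type*} [Field K] [NumberField K] (θ : 𝓞 K) {D : ℕ} (b : ℕ)
    (c : Fin D → ℕ) : 𝓞 K :=
  (b : 𝓞 K) + ∑ i, (c i : 𝓞 K) * θ ^ (i : ℕ)

/-! ### Norms of algebraic integers in a box, and counting them in an ideal -/

section NormBounds

open NumberField Module

variable {K : Type*} [Field K] [NumberField K]

theorem natAbs_norm_eq_prod_norm_embeddings (a : 𝓞 K) :
    (((Algebra.norm ℤ a).natAbs : ℕ) : ℝ) = ∏ σ : K →ₐ[ℚ] ℂ, ‖σ (a : K)‖ := by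
  rw [← norm_prod, ← Algebra.norm_eq_prod_embeddings ℚ ℂ (a : K), ← Algebra.coe_norm_int]
  simp [Nat.cast_natAbs]

theorem natAbs_norm_le_pow (a : 𝓞 K) {R : ℝ} (h : ∀ σ : K →ₐ[ℚ] ℂ, ‖σ (a : K)‖ ≤ R) :
    (((Algebra.norm ℤ a).natAbs : ℕ) : ℝ) ≤ R ^ finrank ℚ K := by
  rw [natAbs_norm_eq_prod_norm_embeddings, ← AlgHom.card ℚ K ℂ]
  exact (Finset.prod_le_prod (fun _ _ => norm_nonneg _) fun σ _ => h σ).trans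
    (by simp [Finset.prod_const])

theorem pow_le_natAbs_norm (a : 𝓞 K) {R : ℝ} (hR : 0 ≤ R)
    (h : ∀ σ : K →ₐ[ℚ] ℂ, R ≤ ‖σ (a : K)‖) :
    R ^ finrank ℚ K ≤ (((Algebra.norm ℤ a).natAbs : ℕ) : ℝ) := by
  rw [natAbs_norm_eq_prod_norm_embeddings, ← AlgHom.card ℚ K ℂ]
  refine le_trans (by simp [Finset.prod_const])
    (Finset.prod_le_prod (fun _ _ => hR) fun σ _ => h σ)

variable {θ : 𝓞 K} (hθ : ∀ σ : K →ₐ[ℚ] ℂ, ‖σ (θ : K)‖ = 1)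
include hθ

theorem norm_embedding_sum_le {D : ℕ} (c : Fin D → ℤ) {y : ℝ} (hc : ∀ i, |(c i : ℝ)| ≤ y)
    (σ : K →ₐ[ℚ] ℂ) :
    ‖σ ((∑ i, (c i : 𝓞 K) * θ ^ (i : ℕ) : 𝓞 K) : K)‖ ≤ D * y := by
  have : σ ((∑ i, (c i : 𝓞 K) * θ ^ (i : ℕ) : 𝓞 K) : K)
      = ∑ i, (c i : ℂ) * σ (θ : K) ^ (i : ℕ) := by
    simp
  rw [this]
  refine (norm_sum_le _ _).trans ?_
  have h : ∀ i ∈ (Finset.univ : Finset (Fin D)), ‖(c i : ℂ) * σ (θ : K) ^ (i : ℕ)‖ ≤ y := by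
    intro i _
    rw [norm_mul, norm_pow, hθ σ]
    simpa using hc i
  simpa using Finset.sum_le_card_nsmul _ _ _ h

/-- The integer shift 2Dx dominates: in every embedding the remaining sum has absolute value at most
Dx. So no conjugate is small, and the norm is comparable to x^D. -/
theorem norm_embedding_boxElement {D x : ℕ} (hD : 0 < D) {c : Fin D → ℕ} (hc : ∀ i, c i < x)
    (σ : K →ₐ[ℚ] ℂ) :
    (x : ℝ) ≤ ‖σ (boxElement θ (2 * D * x) c : K)‖ ∧
      ‖σ (boxElement θ (2 * D * x) c : K)‖ ≤ 3 * D * x := by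
  have h1 := norm_embedding_sum_le hθ (fun i => (c i : ℤ)) (y := x)
    (fun i => by simpa using (hc i).le) σ
  have h2 : σ (boxElement θ (2 * D * x) c : K)
      = (2 * D * x : ℕ) + σ ((∑ i, ((c i : ℤ) : 𝓞 K) * θ ^ (i : ℕ) : 𝓞 K) : K) := by
    simp only [boxElement, map_add, map_natCast, Int.cast_natCast]
  have h3 : ‖((2 * D * x : ℕ) : ℂ)‖ = 2 * D * x := by
    rw [Complex.norm_natCast]; push_cast; ring
  have hD' : (1 : ℝ) ≤ D := by exact_mod_cast hD
  have hx : (0 : ℝ) ≤ x := by positivity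
  rw [h2]
  constructor
  · have := norm_sub_le_norm_add ((2 * D * x : ℕ) : ℂ)
      (σ ((∑ i, ((c i : ℤ) : 𝓞 K) * θ ^ (i : ℕ) : 𝓞 K) : K))
    nlinarith
  · refine (norm_add_le _ _).trans ?_
    nlinarith

theorem natAbs_norm_boxElement {x : ℕ} {c : Fin (finrank ℚ K) → ℕ} (hc : ∀ i, c i < x) :
    x ^ finrank ℚ K ≤ (Algebra.norm ℤ (boxElement θ (2 * finrank ℚ K * x) c)).natAbs ∧
    (Algebra.norm ℤ (boxElement θ (2 * finrank ℚ K * x) c)).natAbs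
      ≤ (3 * finrank ℚ K * x) ^ finrank ℚ K := by
  have hD : 0 < finrank ℚ K := finrank_pos
  have h1 := pow_le_natAbs_norm (boxElement θ (2 * finrank ℚ K * x) c) (Nat.cast_nonneg x)
    fun σ => (norm_embedding_boxElement hθ hD hc σ).1
  have h2 := natAbs_norm_le_pow (boxElement θ (2 * finrank ℚ K * x) c)
    fun σ => (norm_embedding_boxElement hθ hD hc σ).2
  exact ⟨by exact_mod_cast h1, by exact_mod_cast h2⟩

/-- The hypothesis `h` puts both points in one cell of side y. Their difference lies in I, so the
norm of I divides its norm, which is at most (D(y-1))^D and hence smaller; the difference is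
therefore 0. -/
theorem boxElement_eq_of_div_eq (hind : LinearIndependent ℚ fun i : Fin (finrank ℚ K) => (θ : K) ^ (i : ℕ))
    {I : Ideal (𝓞 K)} {b y : ℕ} (hy : 0 < y)
    (hyI : (finrank ℚ K * y) ^ finrank ℚ K ≤ Ideal.absNorm I) {c c' : Fin (finrank ℚ K) → ℕ}
    (hc : boxElement θ b c ∈ I) (hc' : boxElement θ b c' ∈ I) (h : ∀ i, c i / y = c' i / y) :
    c = c' := by
  have hD : 0 < finrank ℚ K := finrank_pos
  set e : Fin (finrank ℚ K) → ℤ := fun i => (c i : ℤ) - c' i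
  have hdiff : boxElement θ b c - boxElement θ b c' = ∑ i, (e i : 𝓞 K) * θ ^ (i : ℕ) := by
    simp [boxElement, e, sub_mul, Finset.sum_sub_distrib]
  have hsmall : ∀ i, |(e i : ℝ)| ≤ ((y - 1 : ℕ) : ℝ) := by
    intro i
    have h1 := Nat.div_add_mod (c i) y
    have h2 := Nat.div_add_mod (c' i) y
    have h3 := Nat.mod_lt (c i) hy
    have h4 := Nat.mod_lt (c' i) hy
    rw [← h i] at h2
    have : |e i| ≤ ((y - 1 : ℕ) : ℤ) := by
      simp only [e]
      rw [abs_le]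
      constructor <;> omega
    exact_mod_cast this
  have hmem : boxElement θ b c - boxElement θ b c' ∈ I := I.sub_mem hc hc'
  have hle := natAbs_norm_le_pow (boxElement θ b c - boxElement θ b c')
    (R := finrank ℚ K * ((y - 1 : ℕ) : ℝ)) fun σ => by
      rw [hdiff]; exact norm_embedding_sum_le hθ e hsmall σ
  have hle' : (Algebra.norm ℤ (boxElement θ b c - boxElement θ b c')).natAbs
      ≤ (finrank ℚ K * (y - 1)) ^ finrank ℚ K := by exact_mod_cast hle
  have hlt : (finrank ℚ K * (y - 1)) ^ finrank ℚ K < (finrank ℚ K * y) ^ finrank ℚ K :=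
    Nat.pow_lt_pow_left (Nat.mul_lt_mul_of_pos_left (by omega) hD) hD.ne'
  have hdvd := Int.natAbs_dvd_natAbs.mpr (Ideal.absNorm_dvd_norm_of_mem hmem)
  rw [Int.natAbs_natCast] at hdvd
  have h0 := Nat.eq_zero_of_dvd_of_lt hdvd (by omega)
  rw [Int.natAbs_eq_zero, Algebra.norm_eq_zero_iff] at h0
  rw [hdiff] at h0
  have h0' : ∑ i, (e i : ℚ) • (θ : K) ^ (i : ℕ) = 0 := by
    have := congrArg (fun z : 𝓞 K => (z : K)) h0
    simpa [Algebra.smul_def] using this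
  have := Fintype.linearIndependent_iff.mp hind (fun i => (e i : ℚ)) h0'
  funext i
  have hi := this i
  simp only [e, Int.cast_eq_zero] at hi
  omega

-- Cut the box into cells of side y, with (Dy)^D just below the norm of I. Each cell holds at most
-- one element of I, which gives the expected count, box volume over norm, up to a constant.
open Classical in
theorem card_boxElement_mem_mul_absNorm_le
    (hind : LinearIndependent ℚ fun i : Fin (finrank ℚ K) => (θ : K) ^ (i : ℕ))
    (I : Ideal (𝓞 K)) {b x : ℕ}
    (hI : Ideal.absNorm I ≤ (3 * finrank ℚ K * x) ^ finrank ℚ K) :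
    ((Fintype.piFinset fun _ : Fin (finrank ℚ K) => Finset.range x).filter
      fun c => boxElement θ b c ∈ I).card * Ideal.absNorm I
      ≤ (8 * finrank ℚ K) ^ finrank ℚ K * x ^ finrank ℚ K := by
  have hD : 0 < finrank ℚ K := finrank_pos
  set D := finrank ℚ K with hDdef
  set F := (Fintype.piFinset fun _ : Fin D => Finset.range x).filter
      fun c => boxElement θ b c ∈ I with hF
  by_cases hsmall : Ideal.absNorm I < D ^ D
  · have h1 : F.card ≤ x ^ D := (Finset.card_filter_le _ _).trans (by simp)
    calc F.card * Ideal.absNorm I ≤ x ^ D * (8 * D) ^ D :=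
          Nat.mul_le_mul h1 (hsmall.le.trans (Nat.pow_le_pow_left (by omega) _))
      _ = _ := by ring
  · push Not at hsmall
    obtain ⟨y, hy, hy1, hy2⟩ : ∃ y, 0 < y ∧ (D * y) ^ D ≤ Ideal.absNorm I ∧
        Ideal.absNorm I < (D * (y + 1)) ^ D := by
      set y := Nat.findGreatest (fun y => (D * y) ^ D ≤ Ideal.absNorm I) (Ideal.absNorm I) with hydef
      have hone : 1 ≤ Ideal.absNorm I := le_trans (Nat.one_le_pow _ _ hD) hsmall
      have h1 : 1 ≤ y := Nat.le_findGreatest hone (by simpa using hsmall)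
      refine ⟨y, h1, Nat.findGreatest_spec (P := fun y => (D * y) ^ D ≤ Ideal.absNorm I) hone
        (by simpa using hsmall), ?_⟩
      by_contra hcon
      push Not at hcon
      have h2 : y + 1 ≤ Ideal.absNorm I := by
        refine le_trans ?_ hcon
        calc y + 1 ≤ D * (y + 1) := Nat.le_mul_of_pos_left _ hD
          _ ≤ (D * (y + 1)) ^ D := Nat.le_self_pow hD.ne' _
      have := Nat.le_findGreatest (P := fun y => (D * y) ^ D ≤ Ideal.absNorm I) h2 hcon
      omega
    have hy3 : y ≤ 3 * x := by
      have := (Nat.pow_le_pow_iff_left hD.ne').mp (hy1.trans hI)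
      nlinarith
    have hcard : F.card ≤ (x / y + 1) ^ D := by
      have : (Fintype.piFinset fun _ : Fin D => Finset.range (x / y + 1)).card = (x / y + 1) ^ D := by
        simp
      rw [← this]
      refine Finset.card_le_card_of_injOn (fun c i => c i / y) ?_ ?_
      · intro c hc
        simp only [hF, Finset.coe_filter, Fintype.mem_piFinset, Finset.mem_range,
          Set.mem_ofPred_eq] at hc
        simp only [Fintype.coe_piFinset, Set.mem_pi, Finset.coe_range, Set.mem_Iio]
        intro i _
        exact Nat.lt_succ_of_le (Nat.div_le_div_right (hc.1 i).le)
      · intro c hc c' hc' heq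
        simp only [hF, Finset.coe_filter, Set.mem_ofPred_eq] at hc hc'
        exact boxElement_eq_of_div_eq hθ hind hy hy1 hc.2 hc'.2 fun i => congrFun heq i
    have hkey : (x / y + 1) * (y + 1) ≤ 8 * x := by
      have := Nat.div_mul_le_self x y
      nlinarith
    calc F.card * Ideal.absNorm I ≤ (x / y + 1) ^ D * (D * (y + 1)) ^ D :=
          Nat.mul_le_mul hcard hy2.le
      _ = (D * ((x / y + 1) * (y + 1))) ^ D := by rw [← mul_pow]; ring
      _ ≤ (D * (8 * x)) ^ D := Nat.pow_le_pow_left (Nat.mul_le_mul_left _ hkey) _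
      _ = _ := by rw [← mul_pow]; ring

end NormBounds

/-! ### A Mertens-type lower bound over prime ideals -/

section PrimeIdealSum

open NumberField Module Real

variable {K : Type*} [Field K] [NumberField K]

-- The exponent of P in I is the number of k ≥ 1 with I ≤ P^k. Prime ideals have norm at least 2, so
-- only k ≤ Y can occur.
open Classical in
theorem log_absNorm_le_sum_card_pow_dvd {I : Ideal (𝓞 K)} (hI : I ≠ ⊥) {Y : ℕ}
    (hY : Ideal.absNorm I ≤ Y) {T : Finset (Ideal (𝓞 K))}
    (hT : ∀ P : Ideal (𝓞 K), P.IsPrime → P ≠ ⊥ → Ideal.absNorm P ≤ Y → P ∈ T) :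
    log (Ideal.absNorm I) ≤
      ∑ P ∈ T, ((Finset.Icc 1 Y).filter fun k => I ≤ P ^ k).card * log (Ideal.absNorm P) := by
  open UniqueFactorizationMonoid in
  have hfac : ∀ P ∈ normalizedFactors I, P.IsPrime ∧ P ≠ ⊥ := fun P hP =>
    ⟨Ideal.isPrime_of_prime (prime_of_normalized_factor P hP),
      (prime_of_normalized_factor P hP).ne_zero⟩
  have hpos : 0 < Ideal.absNorm I := Nat.pos_of_ne_zero (by rwa [Ne, Ideal.absNorm_eq_zero_iff])
  have hprod : Ideal.absNorm I =
      ∏ P ∈ (normalizedFactors I).toFinset, Ideal.absNorm P ^ (normalizedFactors I).count P := by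
    conv_lhs => rw [← Ideal.prod_normalizedFactors_eq_self hI, map_multiset_prod,
      Finset.prod_multiset_map_count]
  have hnorm2 : ∀ P : Ideal (𝓞 K), P.IsPrime → P ≠ ⊥ → 2 ≤ Ideal.absNorm P := by
    intro P hP hP0
    have h0 : Ideal.absNorm P ≠ 0 := by rwa [Ne, Ideal.absNorm_eq_zero_iff]
    have h1 : Ideal.absNorm P ≠ 1 := by
      rw [Ne, Ideal.absNorm_eq_one_iff]; exact hP.ne_top
    omega
  rw [hprod, Nat.cast_prod, log_prod (fun P hP => by
    have := hfac P (Multiset.mem_toFinset.mp hP)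
    have := hnorm2 P this.1 this.2
    positivity)]
  have hsub : (normalizedFactors I).toFinset ⊆ T := by
    intro P hP
    have hP' := Multiset.mem_toFinset.mp hP
    refine hT P (hfac P hP').1 (hfac P hP').2 (le_trans ?_ hY)
    exact Nat.le_of_dvd hpos
      (Ideal.absNorm_dvd_absNorm_of_le (Ideal.le_of_dvd (dvd_of_mem_normalizedFactors hP')))
  refine le_trans (Finset.sum_le_sum fun P hP => ?_)
    (Finset.sum_le_sum_of_subset_of_nonneg hsub fun P _ _ =>
      mul_nonneg (Nat.cast_nonneg _) (log_natCast_nonneg _))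
  have hP' := Multiset.mem_toFinset.mp hP
  obtain ⟨hPp, hP0⟩ := hfac P hP'
  rw [Nat.cast_pow, log_pow]
  refine mul_le_mul_of_nonneg_right ?_ (log_natCast_nonneg _)
  have hle : ∀ k ≤ (normalizedFactors I).count P, I ≤ P ^ k := by
    intro k hk
    refine Ideal.le_of_dvd (dvd_trans (pow_dvd_pow P hk) ?_)
    rw [Ideal.dvd_iff_le]
    conv_lhs => rw [← Ideal.prod_normalizedFactors_eq_self hI]
    rw [← Ideal.dvd_iff_le, Finset.prod_multiset_count]
    exact Finset.dvd_prod_of_mem _ hP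
  have hcountY : (normalizedFactors I).count P ≤ Y := by
    have h1 : Ideal.absNorm (P ^ (normalizedFactors I).count P) ≤ Ideal.absNorm I :=
      Nat.le_of_dvd hpos (Ideal.absNorm_dvd_absNorm_of_le (hle _ le_rfl))
    rw [map_pow] at h1
    exact ((Nat.lt_pow_self (hnorm2 P hPp hP0)).le.trans h1).trans hY
  have hcard : (Finset.Icc 1 ((normalizedFactors I).count P)).card ≤
      ((Finset.Icc 1 Y).filter fun k => I ≤ P ^ k).card := by
    refine Finset.card_le_card fun k hk => ?_
    rw [Finset.mem_Icc] at hk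
    rw [Finset.mem_filter, Finset.mem_Icc]
    exact ⟨⟨hk.1, hk.2.trans hcountY⟩, hle k hk.2⟩
  rw [Nat.card_Icc, Nat.add_sub_cancel] at hcard
  exact_mod_cast hcard

theorem sum_Icc_inv_pow_le {q : ℝ} (hq : 2 ≤ q) (m : ℕ) :
    ∑ k ∈ Finset.Icc 1 m, (q ^ k)⁻¹ ≤ 2 / q := by
  have h : ∀ m : ℕ, ∑ k ∈ Finset.Icc 1 m, (q ^ k)⁻¹ ≤ 2 / q - (q ^ m)⁻¹ * (2 / q) := by
    intro m
    induction m with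
    | zero => simp
    | succ m ih =>
      rw [Finset.sum_Icc_succ_top (by omega)]
      have h1 : (q ^ (m + 1))⁻¹ = (q ^ m)⁻¹ * q⁻¹ := by rw [pow_succ, mul_inv]
      have h2 : 0 < (q ^ m)⁻¹ := by positivity
      have h3 : 0 < q⁻¹ := by positivity
      have h4 : q⁻¹ ≤ 1 / 2 := by rw [inv_le_comm₀ (by linarith) (by norm_num)]; linarith
      rw [div_eq_mul_inv] at ih ⊢
      rw [h1]
      nlinarith [mul_nonneg (mul_pos h2 h3).le (sub_nonneg.mpr h4)]
  have h5 : 0 ≤ (q ^ m)⁻¹ * (2 / q) := by positivity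
  linarith [h m]

-- Chebyshev's argument: factor every element of the box, sum the log norms, and exchange
-- summations. Each prime power P^k contains at most a constant times x^D / N(P)^k elements of the
-- box, and the geometric series in k costs a factor 2.
open Classical in
theorem log_le_sum_log_absNorm_div {θ : 𝓞 K} (hθ : ∀ σ : K →ₐ[ℚ] ℂ, ‖σ (θ : K)‖ = 1)
    (hind : LinearIndependent ℚ fun i : Fin (finrank ℚ K) => (θ : K) ^ (i : ℕ))
    {x : ℕ} (hx : 0 < x) {T : Finset (Ideal (𝓞 K))}
    (hT : ∀ P : Ideal (𝓞 K), P ∈ T ↔ P.IsPrime ∧ P ≠ ⊥ ∧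
      Ideal.absNorm P ≤ (3 * finrank ℚ K * x) ^ finrank ℚ K) :
    log x ≤ 2 * (8 * finrank ℚ K) ^ finrank ℚ K *
      ∑ P ∈ T, log (Ideal.absNorm P) / Ideal.absNorm P := by
  have hD : 0 < finrank ℚ K := finrank_pos
  set D := finrank ℚ K with hDdef
  set Y := (3 * D * x) ^ D with hY
  set box := Fintype.piFinset fun _ : Fin D => Finset.range x with hbox
  set a : (Fin D → ℕ) → 𝓞 K := fun c => boxElement θ (2 * D * x) c with ha
  have hcb : ∀ c ∈ box, ∀ i, c i < x := by
    intro c hc i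
    simpa using (Fintype.mem_piFinset.mp hc) i
  have hlow : ∀ c ∈ box, log x ≤
      ∑ P ∈ T, ((Finset.Icc 1 Y).filter fun k => a c ∈ P ^ k).card * log (Ideal.absNorm P) := by
    intro c hc
    obtain ⟨h1, h2⟩ := natAbs_norm_boxElement hθ (hcb c hc)
    have h3 : Ideal.absNorm (Ideal.span {a c}) = (Algebra.norm ℤ (a c)).natAbs :=
      Ideal.absNorm_span_singleton _
    have hpos : 0 < Ideal.absNorm (Ideal.span {a c}) := by
      rw [h3]; exact lt_of_lt_of_le (by positivity) h1
    have hne : Ideal.span {a c} ≠ ⊥ := by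
      intro h; rw [h, Ideal.absNorm_bot] at hpos; omega
    have h4 := log_absNorm_le_sum_card_pow_dvd hne (Y := Y) (h3 ▸ h2) (T := T)
      (fun P hP hP0 hPY => (hT P).mpr ⟨hP, hP0, hPY⟩)
    simp only [Ideal.span_singleton_le_iff_mem] at h4
    refine le_trans ?_ h4
    rw [h3]
    refine log_le_log (by exact_mod_cast hx) ?_
    exact_mod_cast (Nat.le_self_pow hD.ne' x).trans h1
  have hcount : ∀ P ∈ T, ∀ k : ℕ,
      ((box.filter fun c => a c ∈ P ^ k).card : ℝ) ≤
        (8 * D) ^ D * x ^ D * ((Ideal.absNorm P : ℝ) ^ k)⁻¹ := by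
    intro P hP k
    obtain ⟨hPp, hP0, hPY⟩ := (hT P).mp hP
    have hpos : 0 < Ideal.absNorm P :=
      Nat.pos_of_ne_zero (by rwa [Ne, Ideal.absNorm_eq_zero_iff])
    have hpos' : (0 : ℝ) < (Ideal.absNorm P : ℝ) ^ k := by positivity
    rw [← div_eq_mul_inv, le_div_iff₀ hpos']
    by_cases hk : Ideal.absNorm (P ^ k) ≤ Y
    · have := card_boxElement_mem_mul_absNorm_le hθ hind (P ^ k) (b := 2 * D * x) hk
      rw [map_pow] at this
      exact_mod_cast this
    -- Elements of the box have nonzero norm at most Y, so none lies in an ideal of larger norm.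
    · have : box.filter (fun c => a c ∈ P ^ k) = ∅ := by
        rw [Finset.filter_eq_empty_iff]
        intro c hc hmem
        obtain ⟨h1, h2⟩ := natAbs_norm_boxElement hθ (hcb c hc)
        apply hk
        refine le_trans (Nat.le_of_dvd ?_ ?_) h2
        · exact lt_of_lt_of_le (by positivity) h1
        · simpa using Int.natAbs_dvd_natAbs.mpr (Ideal.absNorm_dvd_norm_of_mem hmem)
      rw [this]
      simp only [Finset.card_empty, Nat.cast_zero, zero_mul]
      positivity
  have hsum : (x : ℝ) ^ D * log x ≤
      ∑ c ∈ box, ∑ P ∈ T, ((Finset.Icc 1 Y).filter fun k => a c ∈ P ^ k).card *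
        log (Ideal.absNorm P) := by
    have := Finset.card_nsmul_le_sum box _ _ hlow
    simpa [hbox] using this
  have hswap : ∀ P ∈ T, ∑ c ∈ box, (((Finset.Icc 1 Y).filter fun k => a c ∈ P ^ k).card : ℝ)
      ≤ (8 * D) ^ D * x ^ D * (2 / Ideal.absNorm P) := by
    intro P hP
    obtain ⟨hPp, hP0, hPY⟩ := (hT P).mp hP
    have h2 : (2 : ℝ) ≤ Ideal.absNorm P := by
      have h0 : Ideal.absNorm P ≠ 0 := by rwa [Ne, Ideal.absNorm_eq_zero_iff]
      have h1 : Ideal.absNorm P ≠ 1 := by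
        rw [Ne, Ideal.absNorm_eq_one_iff]; exact hPp.ne_top
      have : 2 ≤ Ideal.absNorm P := by omega
      exact_mod_cast this
    have h3 := Finset.sum_card_bipartiteAbove_eq_sum_card_bipartiteBelow
      (s := box) (t := Finset.Icc 1 Y) (fun c k => a c ∈ P ^ k)
    simp only [Finset.bipartiteAbove, Finset.bipartiteBelow] at h3
    calc ∑ c ∈ box, (((Finset.Icc 1 Y).filter fun k => a c ∈ P ^ k).card : ℝ)
        = ∑ k ∈ Finset.Icc 1 Y, ((box.filter fun c => a c ∈ P ^ k).card : ℝ) := by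
          exact_mod_cast h3
      _ ≤ ∑ k ∈ Finset.Icc 1 Y, (8 * D) ^ D * x ^ D * ((Ideal.absNorm P : ℝ) ^ k)⁻¹ :=
          Finset.sum_le_sum fun k _ => hcount P hP k
      _ = (8 * D) ^ D * x ^ D * ∑ k ∈ Finset.Icc 1 Y, ((Ideal.absNorm P : ℝ) ^ k)⁻¹ := by
          rw [Finset.mul_sum]
      _ ≤ _ := mul_le_mul_of_nonneg_left (sum_Icc_inv_pow_le h2 Y) (by positivity)
  rw [Finset.sum_comm] at hsum
  have hfin : (x : ℝ) ^ D * log x ≤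
      (x : ℝ) ^ D * (2 * (8 * D) ^ D * ∑ P ∈ T, log (Ideal.absNorm P) / Ideal.absNorm P) := by
    refine hsum.trans ?_
    rw [Finset.mul_sum, Finset.mul_sum]
    refine Finset.sum_le_sum fun P hP => ?_
    rw [← Finset.sum_mul]
    refine (mul_le_mul_of_nonneg_right (hswap P hP) (log_natCast_nonneg _)).trans (le_of_eq ?_)
    ring
  exact le_of_mul_le_mul_left hfin (by positivity)

end PrimeIdealSum

/-! ### From prime ideals of a cyclotomic field to primes congruent to 1 -/

section PrimesCongruentOneLog

open NumberField Module Real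

variable {K : Type*} [Field K] [NumberField K]

/-- If r does not divide L, then θ stays a primitive L-th root of unity in the residue field with r
elements, so L divides r - 1. -/
theorem dvd_or_modEq_one_of_absNorm_eq_prime {L : ℕ} [NeZero L] {θ : 𝓞 K}
    (hθ : IsPrimitiveRoot θ L) {P : Ideal (𝓞 K)} (hP : P.IsPrime) (hP0 : P ≠ ⊥) {r : ℕ}
    (hr : r.Prime) (hPr : Ideal.absNorm P = r) : r ∣ L ∨ r ≡ 1 [MOD L] := by
  by_cases hdvd : r ∣ L
  · exact Or.inl hdvd
  right
  have hmax : P.IsMaximal := hP.isMaximal hP0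
  have : Finite (𝓞 K ⧸ P) := by
    rw [← Ideal.absNorm_ne_zero_iff, hPr]; exact hr.ne_zero
  let _ := Fintype.ofFinite (𝓞 K ⧸ P)
  let _ := Ideal.Quotient.field P
  have hcard : Fintype.card (𝓞 K ⧸ P) = r := by
    rw [← Nat.card_eq_fintype_card, ← hPr]; rfl
  have hL : ((L : ℕ) : 𝓞 K ⧸ P) ≠ 0 := by
    intro h0
    have hr0 : ((r : ℕ) : 𝓞 K ⧸ P) = 0 := by rw [← hcard]; exact Nat.cast_card_eq_zero _
    have hcop : Nat.Coprime L r := ((Nat.Prime.coprime_iff_not_dvd hr).mpr hdvd).symm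
    have h1 := (Nat.isCoprime_iff_coprime.mpr hcop)
    obtain ⟨u, v, huv⟩ := h1
    have := congrArg (Int.cast : ℤ → 𝓞 K ⧸ P) huv
    push_cast at this
    rw [h0, hr0] at this
    simp at this
  have : NeZero ((L : ℕ) : 𝓞 K ⧸ P) := ⟨hL⟩
  have hroot : IsPrimitiveRoot (Ideal.Quotient.mk P θ) L := by
    rw [← Polynomial.isRoot_cyclotomic_iff]
    have h1 := hθ.isRoot_cyclotomic (NeZero.pos L)
    have h2 := h1.map (f := Ideal.Quotient.mk P)
    rwa [Polynomial.map_cyclotomic] at h2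
  have hne : Ideal.Quotient.mk P θ ≠ 0 := hroot.ne_zero (NeZero.ne L)
  have hpow := FiniteField.pow_card_sub_one_eq_one _ hne
  rw [hcard] at hpow
  exact ((Nat.modEq_iff_dvd' hr.one_le).mpr (hroot.dvd_of_pow_eq_one _ hpow)).symm

theorem card_primes_containing_le {r : ℕ} (hr : r.Prime) (T : Finset (Ideal (𝓞 K)))
    (hT : ∀ P ∈ T, P.IsPrime ∧ P ≠ ⊥ ∧ (r : 𝓞 K) ∈ P ∧ r ∣ Ideal.absNorm P) :
    T.card ≤ finrank ℚ K := by
  have h1 : ∏ P ∈ T, P ∣ Ideal.span {(r : 𝓞 K)} := by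
    refine Finset.prod_primes_dvd _ (fun P hP => ?_) fun P hP => ?_
    · exact Ideal.prime_of_isPrime (hT P hP).2.1 (hT P hP).1
    · rw [Ideal.dvd_iff_le, Ideal.span_singleton_le_iff_mem]; exact (hT P hP).2.2.1
  have h2 : Ideal.absNorm (∏ P ∈ T, P) ∣ r ^ finrank ℚ K := by
    have := Ideal.absNorm_dvd_absNorm_of_le (Ideal.le_of_dvd h1)
    rwa [Ideal.absNorm_span_natCast, RingOfIntegers.rank] at this
  rw [map_prod] at h2
  have h3 : r ^ T.card ∣ ∏ P ∈ T, Ideal.absNorm P := by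
    rw [← Finset.prod_const]
    exact Finset.prod_dvd_prod_of_dvd _ _ fun P hP => (hT P hP).2.2.2
  exact (Nat.pow_dvd_pow_iff_le_right hr.one_lt).mp (h3.trans h2)

theorem log_pow_div_pow_le {r f : ℕ} (hr : 2 ≤ r) (hf : 0 < f) :
    log ((r ^ f : ℕ) : ℝ) / ((r ^ f : ℕ) : ℝ) ≤ log r / r := by
  obtain ⟨f, rfl⟩ : ∃ g, f = g + 1 := ⟨f - 1, by omega⟩
  have hr' : (0 : ℝ) < r := by positivity
  have h1 : ((f + 1 : ℕ) : ℝ) ≤ (r : ℝ) ^ f := by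
    have : f < 2 ^ f := Nat.lt_two_pow_self
    have h2 : 2 ^ f ≤ r ^ f := Nat.pow_le_pow_left hr f
    exact_mod_cast (by omega : f + 1 ≤ r ^ f)
  have h0 : 0 ≤ log (r : ℝ) := log_natCast_nonneg r
  rw [Nat.cast_pow, log_pow, div_le_div_iff₀ (by positivity) hr', pow_succ]
  nlinarith [mul_nonneg h0 hr'.le]

theorem log_pow_div_pow_le_rpow {r f : ℕ} (hr : 2 ≤ r) (hf : 2 ≤ f) :
    log ((r ^ f : ℕ) : ℝ) / ((r ^ f : ℕ) : ℝ) ≤ 4 * (r : ℝ) ^ (-(3 / 2) : ℝ) := by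
  have hN : (0 : ℝ) < ((r ^ f : ℕ) : ℝ) := by positivity
  have hr' : (0 : ℝ) < r := by positivity
  have h1 := log_le_rpow_div hN.le (show (0 : ℝ) < 1 / 4 by norm_num)
  have h2 : ((r : ℝ) ^ (2 : ℕ)) ≤ ((r ^ f : ℕ) : ℝ) := by
    exact_mod_cast Nat.pow_le_pow_right (by omega) hf
  calc log ((r ^ f : ℕ) : ℝ) / ((r ^ f : ℕ) : ℝ)
      ≤ (((r ^ f : ℕ) : ℝ) ^ (1 / 4 : ℝ) / (1 / 4)) / ((r ^ f : ℕ) : ℝ) :=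
        div_le_div_of_nonneg_right h1 hN.le
    _ = 4 * ((r ^ f : ℕ) : ℝ) ^ (-(3 / 4) : ℝ) := by
        rw [show (-(3 / 4) : ℝ) = 1 / 4 - 1 by norm_num, rpow_sub_one hN.ne']
        ring
    _ ≤ 4 * ((r : ℝ) ^ (2 : ℕ)) ^ (-(3 / 4) : ℝ) := by
        refine mul_le_mul_of_nonneg_left ?_ (by norm_num)
        exact rpow_le_rpow_of_nonpos (by positivity) h2 (by norm_num)
    _ = _ := by
        rw [← rpow_natCast, ← rpow_mul hr'.le]
        norm_num

/-- Group the ideals by the rational prime r below; at most D lie above each r. Residue degree at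
least 2 contributes a convergent series, and the primes r | L contribute at most 1 each, whence the
term L. -/
theorem sum_log_absNorm_div_le {L : ℕ} [NeZero L] {θ : 𝓞 K} (hθ : IsPrimitiveRoot θ L) {Y : ℕ}
    {T : Finset (Ideal (𝓞 K))}
    (hT : ∀ P ∈ T, P.IsPrime ∧ P ≠ ⊥ ∧ Ideal.absNorm P ≤ Y) :
    ∑ P ∈ T, log (Ideal.absNorm P) / Ideal.absNorm P ≤
      finrank ℚ K * (∑ r ∈ (Finset.range (Y + 1)).filter (fun r => r.Prime ∧ r ≡ 1 [MOD L]),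
        log r / r + L + ∑' r : ℕ, 4 * (r : ℝ) ^ (-(3 / 2) : ℝ)) := by
  have hex : ∀ P : Ideal (𝓞 K), ∃ r f : ℕ, P ∈ T →
      0 < f ∧ (r : 𝓞 K) ∈ P ∧ r.Prime ∧ Ideal.absNorm P = r ^ f := by
    intro P
    by_cases hP : P ∈ T
    · have : P.IsMaximal := (hT P hP).1.isMaximal (hT P hP).2.1
      obtain ⟨r, f, h⟩ := Ideal.exists_prime_and_absNorm_eq_pow P
      exact ⟨r, f, fun _ => h⟩
    · exact ⟨0, 0, fun h => absurd h hP⟩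
  choose ρ f hρ using hex
  set g : ℕ → ℝ := fun r => (if r ≡ 1 [MOD L] then log r / r else 0) + (if r ∣ L then 1 else 0)
    + 4 * (r : ℝ) ^ (-(3 / 2) : ℝ) with hg
  have hg1 : ∀ r : ℕ, 0 ≤ if r ≡ 1 [MOD L] then log (r : ℝ) / r else 0 := by
    intro r; split_ifs
    · exact div_nonneg (log_natCast_nonneg r) (Nat.cast_nonneg r)
    · exact le_rfl
  have hg2 : ∀ r : ℕ, (0 : ℝ) ≤ if r ∣ L then 1 else 0 := by
    intro r; split_ifs <;> norm_num
  have hg3 : ∀ r : ℕ, (0 : ℝ) ≤ 4 * (r : ℝ) ^ (-(3 / 2) : ℝ) := fun r => by positivity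
  have hterm : ∀ P ∈ T, log (Ideal.absNorm P : ℝ) / Ideal.absNorm P ≤ g (ρ P) := by
    intro P hP
    obtain ⟨hf, hmem, hr, hnorm⟩ := hρ P hP
    rw [hnorm]
    rcases Nat.lt_or_ge 1 (f P) with h2 | h1
    · have := log_pow_div_pow_le_rpow hr.two_le h2
      simp only [hg]
      linarith [hg1 (ρ P), hg2 (ρ P)]
    · have hf1 : f P = 1 := by omega
      rw [hf1, pow_one] at hnorm
      have hle := log_pow_div_pow_le hr.two_le hf
      rcases dvd_or_modEq_one_of_absNorm_eq_prime hθ (hT P hP).1 (hT P hP).2.1 hr hnorm with h | h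
      · have h3 : log (ρ P : ℝ) / (ρ P : ℝ) ≤ 1 := by
          have : (0 : ℝ) < ρ P := by exact_mod_cast hr.pos
          rw [div_le_one this]
          linarith [log_le_sub_one_of_pos this]
        have := hg1 (ρ P)
        have := hg3 (ρ P)
        simp only [hg, if_pos h] at *
        linarith
      · have := hg2 (ρ P)
        have := hg3 (ρ P)
        simp only [hg, if_pos h] at *
        linarith
  have hmaps : ∀ P ∈ T, ρ P ∈ (Finset.range (Y + 1)).filter Nat.Prime := by
    intro P hP
    obtain ⟨hf, hmem, hr, hnorm⟩ := hρ P hP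
    rw [Finset.mem_filter, Finset.mem_range]
    refine ⟨?_, hr⟩
    have h1 : ρ P ≤ ρ P ^ f P := Nat.le_self_pow hf.ne' _
    have := (hT P hP).2.2
    omega
  have hfib : ∀ r ∈ (Finset.range (Y + 1)).filter Nat.Prime,
      ∑ P ∈ T with ρ P = r, log (Ideal.absNorm P : ℝ) / Ideal.absNorm P ≤ finrank ℚ K * g r := by
    intro r hr
    have hgr : 0 ≤ g r := by
      have := hg1 r; have := hg2 r; have := hg3 r
      simp only [hg]; linarith
    have h1 : ∀ P ∈ T.filter (fun P => ρ P = r),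
        log (Ideal.absNorm P : ℝ) / Ideal.absNorm P ≤ g r := by
      intro P hP
      rw [Finset.mem_filter] at hP
      rw [← hP.2]; exact hterm P hP.1
    refine (Finset.sum_le_card_nsmul _ _ _ h1).trans ?_
    rw [nsmul_eq_mul]
    refine mul_le_mul_of_nonneg_right ?_ hgr
    have := card_primes_containing_le (Finset.mem_filter.mp hr).2 (T.filter (fun P => ρ P = r)) (by
      intro P hP
      rw [Finset.mem_filter] at hP
      obtain ⟨hf, hmem, hr, hnorm⟩ := hρ P hP.1
      rw [hP.2] at hmem hnorm
      exact ⟨(hT P hP.1).1, (hT P hP.1).2.1, hmem, hnorm ▸ dvd_pow_self r hf.ne'⟩)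
    exact_mod_cast this
  rw [← Finset.sum_fiberwise_of_maps_to hmaps]
  refine (Finset.sum_le_sum hfib).trans ?_
  rw [← Finset.mul_sum]
  refine mul_le_mul_of_nonneg_left ?_ (Nat.cast_nonneg _)
  simp only [hg, Finset.sum_add_distrib]
  refine add_le_add (add_le_add ?_ ?_) ?_
  · rw [← Finset.sum_filter, Finset.filter_filter]
  · rw [← Finset.sum_filter, Finset.sum_const, nsmul_eq_mul, mul_one, Nat.cast_le]
    calc _ ≤ (Finset.Icc 1 L).card := Finset.card_le_card fun r hr => by
          simp only [Finset.mem_filter, Finset.mem_range] at hr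
          exact Finset.mem_Icc.mpr ⟨hr.1.2.pos, Nat.le_of_dvd (NeZero.pos L) hr.2⟩
      _ = L := by simp
  · refine Summable.sum_le_tsum _ (fun r _ => hg3 r) ?_
    exact (summable_nat_rpow.mpr (by norm_num)).mul_left 4

/-- A lower bound for the logarithmic density of the primes congruent to `1` modulo `L`. -/
theorem exists_log_le_sum_log_div_primes_modEq_one : ∃ A : ℝ, 0 ≤ A ∧ ∀ L : ℕ, 0 < L →
    ∀ x : ℕ, 0 < x → log x ≤ 2 * (8 * L.totient) ^ L.totient * (L.totient *
      (∑ r ∈ (Finset.range ((3 * L.totient * x) ^ L.totient + 1)).filter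
        (fun r => r.Prime ∧ r ≡ 1 [MOD L]), log r / r + L + A)) := by
  refine ⟨∑' r : ℕ, 4 * (r : ℝ) ^ (-(3 / 2) : ℝ), tsum_nonneg fun r => by positivity, ?_⟩
  intro L hL x hx
  have : NeZero L := ⟨hL.ne'⟩
  let K := CyclotomicField L ℚ
  have : IsCyclotomicExtension {L} ℚ K := CyclotomicField.isCyclotomicExtension L ℚ
  have : NumberField K := IsCyclotomicExtension.numberField {L} ℚ K
  have hζ := IsCyclotomicExtension.zeta_spec L ℚ K
  have hfr : finrank ℚ K = L.totient :=
    IsCyclotomicExtension.finrank K (Polynomial.cyclotomic.irreducible_rat hL)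
  have hnorm : ∀ σ : K →ₐ[ℚ] ℂ, ‖σ (hζ.toInteger : K)‖ = 1 := fun σ =>
    ((hζ.map_of_injective (f := σ) σ.injective)).norm'_eq_one hL.ne'
  have hind : LinearIndependent ℚ
      fun i : Fin (finrank ℚ K) => (hζ.toInteger : K) ^ (i : ℕ) := by
    have h1 := (hζ.powerBasis ℚ).basis.linearIndependent
    rw [PowerBasis.coe_basis] at h1
    have h2 := h1.comp (Fin.cast (hζ.powerBasis ℚ).finrank) (Fin.cast_injective _)
    exact h2
  set Y := (3 * finrank ℚ K * x) ^ finrank ℚ K with hY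
  have hfin : {P : Ideal (𝓞 K) | P.IsPrime ∧ P ≠ ⊥ ∧ Ideal.absNorm P ≤ Y}.Finite :=
    (Ideal.finite_setOfPred_absNorm_le (S := 𝓞 K) Y).subset fun P hP => hP.2.2
  have h1 := log_le_sum_log_absNorm_div hnorm hind hx (T := hfin.toFinset) (fun P => by simp [hY])
  have h2 := sum_log_absNorm_div_le hζ.toInteger_isPrimitiveRoot (Y := Y) (T := hfin.toFinset)
    (fun P hP => by simpa using hP)
  rw [← hfr]
  exact h1.trans (mul_le_mul_of_nonneg_left h2 (by positivity))

end PrimesCongruentOneLog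

/-! ### Dyadic summation and elementary estimates over all primes -/

section DyadicSums

open Real

theorem sum_filter_range_two_pow (p : ℕ → Prop) [DecidablePred p] (hp : ¬p 0) (f : ℕ → ℝ) (I : ℕ) :
    ∑ r ∈ (Finset.range (2 ^ I)).filter p, f r =
      ∑ i ∈ Finset.range I, ∑ r ∈ (Finset.Ico (2 ^ i) (2 ^ (i + 1))).filter p, f r := by
  induction I with
  | zero => simp [Finset.sum_filter, hp]
  | succ I ih =>
    rw [Finset.sum_range_succ, ← ih]
    simp only [Finset.sum_filter]
    rw [Finset.sum_range_add_sum_Ico _ (Nat.pow_le_pow_right (by norm_num) (Nat.le_succ I))]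

/-- Abel summation removing the weight i+1. The induction carries the stronger `key`, which retains
the weighted mean; the hypothesis is applied to that mean once more at the end. -/
theorem sum_ge_of_weighted_sum_ge {a : ℕ → ℝ} {c κ : ℝ}
    (h : ∀ I : ℕ, 0 < I → (I : ℝ) / c - κ ≤ ∑ i ∈ Finset.range I, (i + 1) * a i) {I : ℕ} (hI : 0 < I) :
    (harmonic I : ℝ) / c - κ ≤ ∑ i ∈ Finset.range I, a i := by
  have key : ∀ I : ℕ, 0 < I → (∑ i ∈ Finset.range I, (i + 1) * a i) / I + ((harmonic I : ℝ) - 1) / c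
      - κ * (1 - 1 / I) ≤ ∑ i ∈ Finset.range I, a i := by
    intro I hI
    induction I, hI using Nat.le_induction with
    | base => simp
    | succ I hI ih =>
      have hI' : (0 : ℝ) < I := by exact_mod_cast hI
      have hS := h I hI
      rw [Finset.sum_range_succ, Finset.sum_range_succ, harmonic_succ]
      set S := ∑ i ∈ Finset.range I, ((i : ℝ) + 1) * a i
      have h1 : (S + (I + 1) * a I) / ((I + 1 : ℕ) : ℝ) = S / I - S * (1 / (I * (I + 1))) + a I := by
        push_cast; field_simp; ring
      have h2 : (I / c - κ) * (1 / (I * (I + 1))) ≤ S * (1 / ((I : ℝ) * (I + 1))) :=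
        mul_le_mul_of_nonneg_right hS (by positivity)
      have h3 : (I / c - κ) * (1 / ((I : ℝ) * (I + 1)))
          = 1 / (I + 1) / c - κ * (1 / I - 1 / (I + 1)) := by
        field_simp; ring
      rw [h1]
      rw [h3] at h2
      push_cast
      rw [inv_eq_one_div, show ((harmonic I : ℝ) + 1 / ((I : ℝ) + 1) - 1) / c
        = ((harmonic I : ℝ) - 1) / c + 1 / ((I : ℝ) + 1) / c by ring]
      linarith
  have hI' : (0 : ℝ) < I := by exact_mod_cast hI
  have h1 := key I hI
  have h2 : (I / c - κ) / I ≤ (∑ i ∈ Finset.range I, ((i : ℝ) + 1) * a i) / I :=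
    div_le_div_of_nonneg_right (h I hI) hI'.le
  have h3 : (I / c - κ) / (I : ℝ) = 1 / c - κ * (1 / I) := by
    field_simp
  have h4 : ((harmonic I : ℝ) - 1) / c = (harmonic I : ℝ) / c - 1 / c := by ring
  linarith

theorem sum_inv_primes_dyadic_le {i : ℕ} (hi : 0 < i) :
    ∑ r ∈ (Finset.Ico (2 ^ i) (2 ^ (i + 1))).filter Nat.Prime, (1 : ℝ) / r ≤ 4 / i := by
  set F := (Finset.Ico (2 ^ i) (2 ^ (i + 1))).filter Nat.Prime with hF
  have hlow : ∀ r ∈ F, 2 ^ i ≤ r := fun r hr =>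
    (Finset.mem_Ico.mp (Finset.mem_filter.mp hr).1).1
  have h1 : (2 ^ i) ^ F.card ≤ ∏ r ∈ F, r := Finset.pow_card_le_prod _ _ _ hlow
  have h2 : ∏ r ∈ F, r ≤ primorial (2 ^ (i + 1)) := by
    refine Finset.prod_le_prod_of_subset_of_one_le' (fun r hr => ?_) fun r hr _ => ?_
    · simp only [hF, Finset.mem_filter, Finset.mem_Ico] at hr
      simp only [Finset.mem_filter, Finset.mem_range]
      exact ⟨by omega, hr.2⟩
    · simp only [Finset.mem_filter] at hr
      exact hr.2.one_le
  have h3 := (h1.trans h2).trans (primorial_le_four_pow _)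
  rw [← pow_mul, show (4 : ℕ) = 2 ^ 2 by norm_num, ← pow_mul] at h3
  have h4 : i * F.card ≤ 2 * 2 ^ (i + 1) := (Nat.pow_le_pow_iff_right (by norm_num)).mp h3
  have hi' : (0 : ℝ) < i := by exact_mod_cast hi
  have h5 : ∀ r ∈ F, (1 : ℝ) / r ≤ 1 / 2 ^ i := by
    intro r hr
    exact one_div_le_one_div_of_le (by positivity) (by exact_mod_cast hlow r hr)
  refine (Finset.sum_le_card_nsmul _ _ _ h5).trans ?_
  rw [nsmul_eq_mul, mul_one_div, div_le_div_iff₀ (by positivity) hi']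
  have h6 : (i : ℝ) * F.card ≤ 2 * 2 ^ (i + 1) := by exact_mod_cast h4
  rw [pow_succ] at h6
  linarith

theorem sum_inv_primes_lt_two_pow_le {I : ℕ} (hI : 0 < I) :
    ∑ r ∈ (Finset.range (2 ^ I)).filter Nat.Prime, (1 : ℝ) / r ≤ 4 + 4 * log I := by
  rw [sum_filter_range_two_pow _ Nat.not_prime_zero]
  obtain ⟨J, rfl⟩ : ∃ J, I = J + 1 := ⟨I - 1, by omega⟩
  have h0 : (Finset.Ico (2 ^ 0) (2 ^ (0 + 1))).filter Nat.Prime = ∅ := by decide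
  rw [Finset.sum_range_succ', h0, Finset.sum_empty, add_zero]
  have h1 : ∀ i ∈ Finset.range J, ∑ r ∈ (Finset.Ico (2 ^ (i + 1)) (2 ^ (i + 1 + 1))).filter Nat.Prime,
      (1 : ℝ) / r ≤ 4 * ((i : ℝ) + 1)⁻¹ := by
    intro i _
    have := sum_inv_primes_dyadic_le (Nat.succ_pos i)
    rw [div_eq_mul_inv] at this
    exact_mod_cast this
  refine (Finset.sum_le_sum h1).trans ?_
  rw [← Finset.mul_sum]
  have h2 : ∑ i ∈ Finset.range J, ((i : ℝ) + 1)⁻¹ = (harmonic J : ℝ) := by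
    simp [harmonic]
  rw [h2]
  have h3 := harmonic_le_one_add_log J
  have h4 : log (J : ℝ) ≤ log ((J + 1 : ℕ) : ℝ) := by
    rcases Nat.eq_zero_or_pos J with h | h
    · simp [h]
    · exact log_le_log (by exact_mod_cast h) (by push_cast; linarith)
  linarith

/-- The inverse product is the sum of 1/m over 2^I-smooth m, which is at least the harmonic sum up
to 2^I - 1. -/
theorem prod_one_sub_inv_primes_lt_two_pow_le {I : ℕ} (hI : 0 < I) :
    ∏ r ∈ (Finset.range (2 ^ I)).filter Nat.Prime, (1 - (1 : ℝ) / r) ≤ 2 / I := by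
  let f : ℕ →* ℝ :=
    { toFun := fun n => (n : ℝ)⁻¹
      map_one' := by simp
      map_mul' := fun m n => by simp [mul_comm] }
  have hf : ∀ {p : ℕ}, p.Prime → ‖f p‖ < 1 := by
    intro p hp
    have : (1 : ℝ) < p := by exact_mod_cast hp.one_lt
    simpa [f, abs_of_pos (zero_lt_one.trans this)] using inv_lt_one_of_one_lt₀ this
  obtain ⟨hsum, hhas⟩ :=
    EulerProduct.summable_and_hasSum_smoothNumbers_prod_primesBelow_geometric hf (2 ^ I)
  set N := 2 ^ I with hN
  have hNpos : 0 < N := by positivity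
  have hlow : (harmonic (N - 1) : ℝ) ≤ ∏ p ∈ N.primesBelow, (1 - f p)⁻¹ := by
    have hinj : Function.Injective fun m : Fin (N - 1) =>
        (⟨(m : ℕ) + 1, Nat.mem_smoothNumbers_of_lt (Nat.succ_pos _) (by omega)⟩ :
          N.smoothNumbers) := by
      intro a b hab
      simpa [Fin.ext_iff] using hab
    have h1 := hhas.summable.sum_le_tsum
      (Finset.univ.map ⟨_, hinj⟩) (fun m _ => by simp [f])
    rw [hhas.tsum_eq, Finset.sum_map] at h1
    refine le_trans (le_of_eq ?_) h1
    simp [harmonic, f, Finset.sum_range]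
  have hlog : (I : ℝ) / 2 ≤ harmonic (N - 1) := by
    have h1 := log_add_one_le_harmonic (N - 1)
    have h2 : ((N - 1 : ℕ) : ℝ) + 1 = 2 ^ I := by
      have : N - 1 + 1 = 2 ^ I := by omega
      exact_mod_cast this
    have h3 : Real.log (((N - 1 : ℕ) : ℝ) + 1) = I * log 2 := by rw [h2, log_pow]
    have h4 : (I : ℝ) * (1 / 2) ≤ I * log 2 :=
      mul_le_mul_of_nonneg_left (by have := log_two_gt_d9; linarith) (Nat.cast_nonneg _)
    push_cast at h1
    rw [← h3] at h4
    linarith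
  have hI' : (0 : ℝ) < I / 2 := by
    have : (0 : ℝ) < I := by exact_mod_cast hI
    linarith
  have hprod : ∏ r ∈ (Finset.range N).filter Nat.Prime, (1 - (1 : ℝ) / r)
      = (∏ p ∈ N.primesBelow, (1 - f p)⁻¹)⁻¹ := by
    rw [← Finset.prod_inv_distrib]
    refine Finset.prod_congr rfl fun r _ => ?_
    simp [f]
  rw [hprod]
  refine (inv_anti₀ hI' (hlog.trans hlow)).trans (le_of_eq ?_)
  rw [inv_div]

end DyadicSums

/-! ### Reciprocals of primes congruent to 1 modulo L -/

section ReciprocalSum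

open Real

/-- The reciprocal of a lower bound for the logarithmic density of the primes congruent to `1`
modulo `L`. -/
def densityDenominator (L : ℕ) : ℕ := 2 * (8 * L) ^ L * L ^ 2

theorem densityDenominator_ge {L : ℕ} (hL : 0 < L) : L ^ 2 ≤ densityDenominator L :=
  Nat.le_mul_of_pos_left _ (by positivity)

/-- Of the factor L^2 in `densityDenominator`, one L bounds the field degree and the other comes
from the range of the primes, which reaches about the D-th power of x. -/
theorem exists_le_densityDenominator_mul_sum : ∃ A : ℕ, ∀ L : ℕ, 0 < L → ∀ I : ℕ,
    (I : ℝ) ≤ densityDenominator L * ((∑ r ∈ (Finset.range (2 ^ I)).filter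
      (fun r => r.Prime ∧ r ≡ 1 [MOD L]), log r / r) / log 2 + (3 * L + A : ℕ)) := by
  obtain ⟨A₀, hA₀, hA⟩ := exists_log_le_sum_log_div_primes_modEq_one
  obtain ⟨A₁, hA₁⟩ := exists_nat_ge A₀
  refine ⟨2 * A₁ + 3, fun L hL I => ?_⟩
  set T : ℕ → ℝ := fun Y => ∑ r ∈ (Finset.range Y).filter
      (fun r => r.Prime ∧ r ≡ 1 [MOD L]), log r / r with hT
  have hTmono : Monotone T := fun Y Z h => Finset.sum_le_sum_of_subset_of_nonneg
    (Finset.filter_subset_filter _ (Finset.range_subset_range.mpr h))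
    fun r _ _ => div_nonneg (log_natCast_nonneg r) (Nat.cast_nonneg r)
  have hT0 : ∀ Y, 0 ≤ T Y := fun Y => Finset.sum_nonneg
    fun r _ => div_nonneg (log_natCast_nonneg r) (Nat.cast_nonneg r)
  have hlog2 : (1 / 2 : ℝ) ≤ log 2 := by have := log_two_gt_d9; linarith
  have hlog2pos : 0 < log 2 := by linarith
  have hL1 : (1 : ℝ) ≤ L := by exact_mod_cast hL
  have hA0' : (0 : ℝ) ≤ A₁ := Nat.cast_nonneg _
  set M : ℝ := 2 * (8 * L) ^ L with hM
  have hM1 : 1 ≤ M := by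
    have : (1 : ℝ) ≤ (8 * L) ^ L := one_le_pow₀ (by linarith)
    linarith
  have hc : (densityDenominator L : ℝ) = M * L ^ 2 := by
    simp [densityDenominator, hM]
  rw [hc]
  change (I : ℝ) ≤ M * L ^ 2 * (T (2 ^ I) / log 2 + (3 * L + (2 * A₁ + 3) : ℕ))
  push_cast
  have hS0 : 0 ≤ T (2 ^ I) / log 2 := div_nonneg (hT0 _) hlog2pos.le
  have hD : L.totient ≤ L := Nat.totient_le L
  have hD1 : 1 ≤ L.totient := Nat.totient_pos.mpr hL
  by_cases hI : I < L * (L + 2)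
  · have h1 : (I : ℝ) ≤ L * (L + 2) := by exact_mod_cast hI.le
    nlinarith [mul_nonneg (sub_nonneg.mpr hM1) (sq_nonneg (L : ℝ)),
      mul_nonneg (mul_nonneg (zero_le_one.trans hM1) (sq_nonneg (L : ℝ)))
        (by positivity : (0 : ℝ) ≤ T (2 ^ I) / log 2 + (2 * L + 2 * A₁)),
      mul_nonneg (mul_nonneg (sub_nonneg.mpr hM1) (sq_nonneg (L : ℝ)))
        (by positivity : (0 : ℝ) ≤ L + 3)]
  push Not at hI
  -- The choice x = 2^i with i about I/L makes (3 φ(L) x)^φ(L) fit below 2^I; the offset L+2 absorbs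
  -- the factor 3 φ(L).
  obtain ⟨i, hi⟩ : ∃ i, I / L = i + (L + 2) := by
    refine ⟨I / L - (L + 2), ?_⟩
    have := (Nat.le_div_iff_mul_le hL).mpr (show (L + 2) * L ≤ I by rwa [Nat.mul_comm])
    omega
  have hIle : I ≤ L * (i + L + 3) := by
    have := Nat.lt_mul_div_succ I hL
    rw [hi] at this
    exact this.le.trans (by ring_nf; rfl)
  have hIge : (i + (L + 2)) * L ≤ I := by rw [← hi]; exact Nat.div_mul_le_self I L
  have hY : (3 * L.totient * 2 ^ i) ^ L.totient + 1 ≤ 2 ^ I := by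
    have h1 : 3 * L.totient < 2 ^ (L + 2) := by
      have : L < 2 ^ L := Nat.lt_two_pow_self
      rw [pow_add]; omega
    have h2 : 3 * L.totient * 2 ^ i < 2 ^ (i + (L + 2)) := by
      rw [pow_add 2 i, mul_comm (2 ^ i)]
      exact Nat.mul_lt_mul_of_pos_right h1 (by positivity)
    calc (3 * L.totient * 2 ^ i) ^ L.totient + 1
        ≤ (2 ^ (i + (L + 2))) ^ L.totient := Nat.pow_lt_pow_left h2 (by omega)
      _ ≤ (2 ^ (i + (L + 2))) ^ L := Nat.pow_le_pow_right (by positivity) hD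
      _ ≤ 2 ^ I := by rw [← pow_mul]; exact Nat.pow_le_pow_right (by norm_num) hIge
  have hmain := hA L hL (2 ^ i) (by positivity)
  have hmain' : log ((2 ^ i : ℕ) : ℝ) ≤ M * (L * (T (2 ^ I) + L + A₁)) := by
    refine hmain.trans (mul_le_mul ?_ ?_ ?_ (by positivity))
    · have : (8 * L.totient) ^ L.totient ≤ (8 * L) ^ L :=
        (Nat.pow_le_pow_left (Nat.mul_le_mul_left _ hD) _).trans
          (Nat.pow_le_pow_right (by omega) hD)
      have h' : ((8 : ℝ) * L.totient) ^ L.totient ≤ (8 * L) ^ L := by exact_mod_cast this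
      rw [hM]; linarith
    · refine mul_le_mul (by exact_mod_cast hD) ?_ ?_ (by positivity)
      · have := hTmono hY
        simp only [hT] at this ⊢
        linarith
      · have := hT0 ((3 * L.totient * 2 ^ i) ^ L.totient + 1)
        simp only [hT] at this
        positivity
    · have := hT0 ((3 * L.totient * 2 ^ i) ^ L.totient + 1)
      simp only [hT] at this
      positivity
  rw [Nat.cast_pow, log_pow, Nat.cast_ofNat] at hmain'
  set S := T (2 ^ I) / log 2 with hS
  have hTS : T (2 ^ I) = S * log 2 := by rw [hS]; field_simp
  have hi2 : (i : ℝ) ≤ M * (L * (S + 2 * L + 2 * A₁)) := by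
    refine le_of_mul_le_mul_right (hmain'.trans ?_) hlog2pos
    rw [hTS, mul_assoc M, mul_assoc (L : ℝ)]
    refine mul_le_mul_of_nonneg_left (mul_le_mul_of_nonneg_left ?_ (by positivity)) (by positivity)
    nlinarith
  have h3 : (I : ℝ) ≤ L * (i + L + 3) := by exact_mod_cast hIle
  have h4 : (L : ℝ) * i ≤ L * (M * (L * (S + 2 * L + 2 * A₁))) :=
    mul_le_mul_of_nonneg_left hi2 (by positivity)
  have h5 : (L : ℝ) ≤ M * L ^ 2 := by nlinarith [mul_nonneg (sub_nonneg.mpr hM1) (sq_nonneg (L : ℝ))]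
  have h6 : (L : ℝ) * (L + 3) ≤ M * L ^ 2 * (L + 3) :=
    mul_le_mul_of_nonneg_right h5 (by positivity)
  nlinarith

theorem exists_log_div_sub_le_sum_inv_primes_modEq_one : ∃ A : ℕ, ∀ L : ℕ, 0 < L →
    ∀ I : ℕ, 0 < I → log I / densityDenominator L - (3 * L + A : ℕ) ≤
      ∑ r ∈ (Finset.range (2 ^ I)).filter (fun r => r.Prime ∧ r ≡ 1 [MOD L]), (1 : ℝ) / r := by
  obtain ⟨A, hA⟩ := exists_le_densityDenominator_mul_sum
  refine ⟨A, fun L hL I hI => ?_⟩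
  have hp0 : ¬(Nat.Prime 0 ∧ 0 ≡ 1 [MOD L]) := fun h => Nat.not_prime_zero h.1
  have hcpos : (0 : ℝ) < densityDenominator L := by
    have := densityDenominator_ge hL
    have h2 : 0 < L ^ 2 := by positivity
    exact_mod_cast h2.trans_le this
  have hlog2 : 0 < log 2 := log_pos (by norm_num)
  rw [sum_filter_range_two_pow _ hp0]
  refine le_trans ?_ (sum_ge_of_weighted_sum_ge (c := densityDenominator L)
    (κ := (3 * L + A : ℕ)) (fun J _ => ?_) hI)
  · have h1 : log (I : ℝ) ≤ harmonic I := by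
      refine le_trans (log_le_log (by exact_mod_cast hI) ?_) (log_add_one_le_harmonic I)
      push_cast; linarith
    have := div_le_div_of_nonneg_right h1 hcpos.le
    linarith
  · have h1 := hA L hL J
    rw [sub_le_iff_le_add, div_le_iff₀' hcpos]
    refine h1.trans (mul_le_mul_of_nonneg_left ?_ hcpos.le)
    refine add_le_add ?_ le_rfl
    rw [div_le_iff₀ hlog2, sum_filter_range_two_pow _ hp0, Finset.sum_mul]
    refine Finset.sum_le_sum fun i _ => ?_
    rw [Finset.mul_sum, Finset.sum_mul]
    refine Finset.sum_le_sum fun r hr => ?_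
    simp only [Finset.mem_filter, Finset.mem_Ico] at hr
    have hr0 : (0 : ℝ) < r := by exact_mod_cast hr.2.1.pos
    have h2 : log (r : ℝ) ≤ (i + 1) * log 2 := by
      have : log (r : ℝ) ≤ log ((2 : ℝ) ^ (i + 1)) :=
        log_le_log hr0 (by exact_mod_cast hr.1.2.le)
      rw [log_pow] at this
      exact_mod_cast this
    rw [mul_one_div, div_mul_eq_mul_div]
    exact div_le_div_of_nonneg_right h2 hr0.le

end ReciprocalSum

/-! ### Brun's pure sieve -/

section BrunSieve

/-- Bonferroni's inequality: for nonempty B the truncated alternating sum is the binomial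
coefficient of |B| - 1 over 2k, which is nonnegative. -/
theorem ite_eq_empty_le_sum_powerset {ι : Type*} [DecidableEq ι] (B : Finset ι) (k : ℕ) :
    (if B = ∅ then (1 : ℝ) else 0) ≤ ∑ D ∈ B.powerset with D.card ≤ 2 * k, (-1 : ℝ) ^ D.card := by
  have h1 : ∑ D ∈ B.powerset with D.card ≤ 2 * k, (-1 : ℝ) ^ D.card
      = ((∑ j ∈ Finset.range (2 * k + 1), (-1) ^ j * (B.card.choose j : ℤ) : ℤ) : ℝ) := by
    have hmaps : ∀ D ∈ B.powerset.filter (fun D => D.card ≤ 2 * k),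
        D.card ∈ Finset.range (2 * k + 1) := by
      intro D hD
      rw [Finset.mem_range]
      have := (Finset.mem_filter.mp hD).2
      omega
    rw [← Finset.sum_fiberwise_of_maps_to hmaps]
    push_cast
    refine Finset.sum_congr rfl fun j hj => ?_
    rw [Finset.mem_range] at hj
    have h2 : (B.powerset.filter (fun D => D.card ≤ 2 * k)).filter (fun D => D.card = j)
        = B.powersetCard j := by
      ext D
      simp only [Finset.mem_filter, Finset.mem_powerset, Finset.mem_powersetCard]
      constructor
      · exact fun h => ⟨h.1.1, h.2⟩
      · exact fun h => ⟨⟨h.1, by omega⟩, h.2⟩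
    rw [h2, Finset.sum_congr rfl (g := fun _ => (-1 : ℝ) ^ j)
      (fun D hD => by rw [(Finset.mem_powersetCard.mp hD).2]), Finset.sum_const,
      Finset.card_powersetCard, nsmul_eq_mul, mul_comm]
  rw [h1]
  by_cases hB : B = ∅
  · subst hB
    rw [if_pos rfl, Finset.sum_range_succ', Finset.sum_eq_zero (fun i _ => by simp)]
    simp
  · rw [if_neg hB]
    obtain ⟨m, hm⟩ : ∃ m, B.card = m + 1 :=
      ⟨B.card - 1, by have := Finset.card_pos.mpr (Finset.nonempty_iff_ne_empty.mpr hB); omega⟩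
    rw [hm, Int.alternating_sum_range_choose_eq_choose, pow_mul]
    simp

theorem abs_card_modEq_sub_le (a X v : ℕ) {d : ℕ} (hd : 0 < d) :
    |(((Finset.Ico a (a + X)).filter fun m => m ≡ v [MOD d]).card : ℝ) - X / d| ≤ 1 := by
  have h := Nat.Ico_filter_modEq_card a (a + X) hd v
  have h' : (((Finset.Ico a (a + X)).filter fun m => m ≡ v [MOD d]).card : ℝ)
      = ((max (⌈(((a + X : ℕ) : ℚ) - v) / d⌉ - ⌈((a : ℚ) - v) / d⌉) 0 : ℤ) : ℝ) := by
    exact_mod_cast congrArg (Int.cast : ℤ → ℝ) h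
  have hd' : (0 : ℚ) < d := by exact_mod_cast hd
  set u : ℚ := ((a : ℚ) - v) / d with hu
  have hw : (((a + X : ℕ) : ℚ) - v) / d = u + X / d := by
    rw [hu]; push_cast; ring
  rw [hw] at h'
  have hX : (0 : ℚ) ≤ X / d := by positivity
  have hmono : ⌈u⌉ ≤ ⌈u + (X : ℚ) / d⌉ := Int.ceil_le_ceil (by linarith)
  rw [max_eq_left (by omega)] at h'
  have h1 := Int.ceil_lt_add_one u
  have h2 := Int.le_ceil u
  have h3 := Int.ceil_lt_add_one (u + (X : ℚ) / d)
  have h4 := Int.le_ceil (u + (X : ℚ) / d)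
  have h5 : |((⌈u + (X : ℚ) / d⌉ - ⌈u⌉ : ℤ) : ℚ) - X / d| ≤ 1 := by
    push_cast
    rw [abs_le]; constructor <;> linarith
  have h6 := (Rat.cast_le (K := ℝ)).mpr h5
  rw [h']
  simpa only [Rat.cast_abs, Rat.cast_sub, Rat.cast_div, Rat.cast_natCast, Rat.cast_intCast,
    Rat.cast_one] using h6

/-- By the Chinese remainder theorem the conditions amount to ∏ |Ω r| classes, each counted with
error at most 1. The extra class v mod d is what the induction on D accumulates. -/
theorem abs_card_residues_sub_le (a X : ℕ) (Ω : ℕ → Finset ℕ) (D : Finset ℕ) :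
    ∀ (d v : ℕ), 0 < d → (∀ r ∈ D, 0 < r ∧ Nat.Coprime d r ∧ ∀ c ∈ Ω r, c < r) →
      (D : Set ℕ).Pairwise Nat.Coprime →
    |(((Finset.Ico a (a + X)).filter fun m => m ≡ v [MOD d] ∧ ∀ r ∈ D, m % r ∈ Ω r).card : ℝ)
      - X / d * ∏ r ∈ D, ((Ω r).card : ℝ) / r| ≤ ∏ r ∈ D, ((Ω r).card : ℝ) := by
  induction D using Finset.induction_on with
  | empty =>
    intro d v hd _ _
    simpa using abs_card_modEq_sub_le a X v hd
  | insert r D hr ih =>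
    intro d v hd hD hpw
    obtain ⟨hr0, hdr, hΩ⟩ := hD r (Finset.mem_insert_self r D)
    have hcop : ∀ r' ∈ D, Nat.Coprime r r' := fun r' hr' =>
      hpw (Finset.mem_coe.mpr (Finset.mem_insert_self r D))
        (Finset.mem_coe.mpr (Finset.mem_insert_of_mem hr')) (fun h => hr (h ▸ hr'))
    set w : ℕ → ℕ := fun c => (Nat.chineseRemainder hdr v c : ℕ) with hw
    have hstep : ∀ c ∈ Ω r, |(((Finset.Ico a (a + X)).filter fun m =>
        m ≡ w c [MOD d * r] ∧ ∀ r' ∈ D, m % r' ∈ Ω r').card : ℝ)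
        - X / (d * r : ℕ) * ∏ r' ∈ D, ((Ω r').card : ℝ) / r'| ≤ ∏ r' ∈ D, ((Ω r').card : ℝ) := by
      intro c _
      refine ih (d * r) (w c) (by positivity) (fun r' hr' => ?_)
        (hpw.mono (Finset.coe_subset.mpr (Finset.subset_insert r D)))
      obtain ⟨h1, h2, h3⟩ := hD r' (Finset.mem_insert_of_mem hr')
      exact ⟨h1, Nat.Coprime.mul_left h2 (hcop r' hr'), h3⟩
    have hsplit : (Finset.Ico a (a + X)).filter
        (fun m => m ≡ v [MOD d] ∧ ∀ r' ∈ insert r D, m % r' ∈ Ω r')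
        = (Ω r).biUnion fun c => (Finset.Ico a (a + X)).filter fun m =>
          m ≡ w c [MOD d * r] ∧ ∀ r' ∈ D, m % r' ∈ Ω r' := by
      ext m
      simp only [Finset.mem_filter, Finset.mem_biUnion, Finset.forall_mem_insert]
      constructor
      · rintro ⟨hm, h1, h2, h3⟩
        refine ⟨m % r, h2, hm, ?_, h3⟩
        exact Nat.chineseRemainder_modEq_unique hdr h1 (Nat.mod_modEq m r).symm
      · rintro ⟨c, hc, hm, h1, h3⟩
        have h4 : m ≡ v [MOD d] := (h1.of_mul_right r).trans (Nat.chineseRemainder hdr v c).2.1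
        have h5 : m ≡ c [MOD r] := (h1.of_mul_left d).trans (Nat.chineseRemainder hdr v c).2.2
        refine ⟨hm, h4, ?_, h3⟩
        have h6 : m % r = c := by
          rw [h5, Nat.mod_eq_of_lt (hΩ c hc)]
        rwa [h6]
    have hcard : (((Finset.Ico a (a + X)).filter
        (fun m => m ≡ v [MOD d] ∧ ∀ r' ∈ insert r D, m % r' ∈ Ω r')).card : ℝ)
        = ∑ c ∈ Ω r, (((Finset.Ico a (a + X)).filter fun m =>
          m ≡ w c [MOD d * r] ∧ ∀ r' ∈ D, m % r' ∈ Ω r').card : ℝ) := by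
      rw [hsplit, Finset.card_biUnion]
      · push_cast; rfl
      · intro c hc c' hc' hne
        refine Finset.disjoint_left.mpr fun m hm hm' => ?_
        simp only [Finset.mem_filter] at hm hm'
        apply hne
        have h5 : m ≡ c [MOD r] :=
          (hm.2.1.of_mul_left d).trans (Nat.chineseRemainder hdr v c).2.2
        have h5' : m ≡ c' [MOD r] :=
          (hm'.2.1.of_mul_left d).trans (Nat.chineseRemainder hdr v c').2.2
        have := h5.symm.trans h5'
        rwa [Nat.ModEq, Nat.mod_eq_of_lt (hΩ c hc), Nat.mod_eq_of_lt (hΩ c' hc')] at this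
    have hr0' : (r : ℝ) ≠ 0 := by positivity
    have hd' : (d : ℝ) ≠ 0 := by positivity
    have hmainterm : (X : ℝ) / d * ∏ r' ∈ insert r D, ((Ω r').card : ℝ) / r'
        = ∑ c ∈ Ω r, (X : ℝ) / (d * r : ℕ) * ∏ r' ∈ D, ((Ω r').card : ℝ) / r' := by
      rw [Finset.prod_insert hr, Finset.sum_const, nsmul_eq_mul]
      rw [Nat.cast_mul]
      generalize ∏ r' ∈ D, ((Ω r').card : ℝ) / r' = G
      field_simp
    rw [hcard, hmainterm, ← Finset.sum_sub_distrib, Finset.prod_insert hr]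
    refine (Finset.abs_sum_le_sum_abs _ _).trans ?_
    refine (Finset.sum_le_card_nsmul _ _ _ hstep).trans (le_of_eq ?_)
    rw [nsmul_eq_mul]

/-- Rankin's trick: the weight W^(K - |D|) is at least 1 on the retained sets. -/
theorem sum_powerset_filter_card_le_prod {R : Finset ℕ} {ρ : ℕ → ℝ} (hρ : ∀ r ∈ R, 0 ≤ ρ r)
    {W : ℝ} (hW : 1 ≤ W) (K : ℕ) :
    ∑ D ∈ R.powerset with D.card ≤ K, ∏ r ∈ D, ρ r ≤ W ^ K * ∏ r ∈ R, (1 + ρ r / W) := by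
  have hW0 : 0 < W := by linarith
  rw [Finset.prod_one_add, Finset.mul_sum]
  refine le_trans (Finset.sum_le_sum fun D hD => ?_)
    (Finset.sum_le_sum_of_subset_of_nonneg (Finset.filter_subset _ _) fun D hD _ => ?_)
  · obtain ⟨hD, hK⟩ := Finset.mem_filter.mp hD
    have h0 : 0 ≤ ∏ r ∈ D, ρ r := Finset.prod_nonneg fun r hr => hρ r (Finset.mem_powerset.mp hD hr)
    rw [Finset.prod_div_distrib, Finset.prod_const, mul_div_assoc', le_div_iff₀ (by positivity),
      mul_comm]
    exact mul_le_mul_of_nonneg_right (pow_le_pow_right₀ hW hK) h0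
  · exact mul_nonneg (by positivity) (Finset.prod_nonneg fun r hr =>
      div_nonneg (hρ r (Finset.mem_powerset.mp hD hr)) hW0.le)

/-- The full alternating sum is the product; on the discarded sets, |D| > 2k makes 4^(-k) 2^|D| at
least 1. -/
theorem sum_powerset_filter_card_alternating_le {R : Finset ℕ} {g : ℕ → ℝ}
    (hg : ∀ r ∈ R, 0 ≤ g r) (k : ℕ) :
    ∑ D ∈ R.powerset with D.card ≤ 2 * k, (-1 : ℝ) ^ D.card * ∏ r ∈ D, g r ≤
      ∏ r ∈ R, (1 - g r) + (1 / 4) ^ k * ∏ r ∈ R, (1 + 2 * g r) := by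
  have h1 : ∏ r ∈ R, (1 - g r) = ∑ D ∈ R.powerset, (-1 : ℝ) ^ D.card * ∏ r ∈ D, g r := by
    simp_rw [sub_eq_add_neg]
    rw [Finset.prod_one_add]
    refine Finset.sum_congr rfl fun D _ => ?_
    rw [Finset.prod_neg]
  rw [h1, ← Finset.sum_filter_add_sum_filter_not R.powerset (fun D => D.card ≤ 2 * k), add_assoc,
    le_add_iff_nonneg_right, Finset.prod_one_add, Finset.mul_sum]
  have h2 : ∑ D ∈ R.powerset with ¬D.card ≤ 2 * k, -((-1 : ℝ) ^ D.card * ∏ r ∈ D, g r)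
      ≤ ∑ D ∈ R.powerset, (1 / 4 : ℝ) ^ k * ∏ r ∈ D, 2 * g r := by
    refine le_trans (Finset.sum_le_sum fun D hD => ?_)
      (Finset.sum_le_sum_of_subset_of_nonneg (Finset.filter_subset _ _) fun D hD _ => ?_)
    · obtain ⟨hD, hK⟩ := Finset.mem_filter.mp hD
      have h0 : 0 ≤ ∏ r ∈ D, g r :=
        Finset.prod_nonneg fun r hr => hg r (Finset.mem_powerset.mp hD hr)
      rw [Finset.prod_mul_distrib, Finset.prod_const, ← mul_assoc]
      have h3 : (1 : ℝ) ≤ (1 / 4) ^ k * 2 ^ D.card := by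
        have h4 : (2 : ℝ) ^ (2 * k) ≤ 2 ^ D.card := pow_le_pow_right₀ (by norm_num) (by omega)
        calc (1 : ℝ) = (1 / 4) ^ k * 2 ^ (2 * k) := by rw [pow_mul, ← mul_pow]; norm_num
          _ ≤ _ := mul_le_mul_of_nonneg_left h4 (by positivity)
      have h5 : -((-1 : ℝ) ^ D.card * ∏ r ∈ D, g r) ≤ 1 * ∏ r ∈ D, g r := by
        rcases neg_one_pow_eq_or ℝ D.card with h | h <;> rw [h] <;> linarith
      exact h5.trans (mul_le_mul_of_nonneg_right h3 h0)
    · exact mul_nonneg (by positivity) (Finset.prod_nonneg fun r hr =>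
        mul_nonneg zero_le_two (hg r (Finset.mem_powerset.mp hD hr)))
  rw [Finset.sum_neg_distrib] at h2
  linarith

/-- Brun's pure sieve, as an upper bound for the number of integers of an interval that avoid
given residue classes to pairwise coprime moduli. -/
theorem card_avoiding_residues_le (a X k : ℕ) (R : Finset ℕ) (Ω : ℕ → Finset ℕ)
    (hR : ∀ r ∈ R, 0 < r ∧ ∀ c ∈ Ω r, c < r) (hpw : (R : Set ℕ).Pairwise Nat.Coprime)
    {W : ℝ} (hW : 1 ≤ W) :
    (((Finset.Ico a (a + X)).filter fun m => ∀ r ∈ R, m % r ∉ Ω r).card : ℝ) ≤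
      X * (∏ r ∈ R, (1 - ((Ω r).card : ℝ) / r) +
        (1 / 4) ^ k * ∏ r ∈ R, (1 + 2 * (((Ω r).card : ℝ) / r))) +
      W ^ (2 * k) * ∏ r ∈ R, (1 + ((Ω r).card : ℝ) / W) := by
  set S := Finset.Ico a (a + X) with hS
  set bad : ℕ → Finset ℕ := fun m => R.filter fun r => m % r ∈ Ω r with hbad
  set cnt : Finset ℕ → ℝ := fun D => ((S.filter fun m => ∀ r ∈ D, m % r ∈ Ω r).card : ℝ) with hcnt
  have h1 : ((S.filter fun m => ∀ r ∈ R, m % r ∉ Ω r).card : ℝ)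
      = ∑ m ∈ S, if bad m = ∅ then (1 : ℝ) else 0 := by
    rw [Finset.card_filter]
    push_cast
    refine Finset.sum_congr rfl fun m _ => ?_
    simp only [hbad, Finset.filter_eq_empty_iff]
  have h2 : ∑ m ∈ S, (if bad m = ∅ then (1 : ℝ) else 0)
      ≤ ∑ D ∈ R.powerset with D.card ≤ 2 * k, (-1 : ℝ) ^ D.card * cnt D := by
    refine (Finset.sum_le_sum fun m _ => ite_eq_empty_le_sum_powerset (bad m) k).trans
      (le_of_eq ?_)
    have h3 : ∀ m ∈ S, ∑ D ∈ (bad m).powerset with D.card ≤ 2 * k, (-1 : ℝ) ^ D.card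
        = ∑ D ∈ R.powerset with D.card ≤ 2 * k,
          if ∀ r ∈ D, m % r ∈ Ω r then (-1 : ℝ) ^ D.card else 0 := by
      intro m _
      rw [← Finset.sum_filter, Finset.filter_filter]
      refine Finset.sum_congr ?_ fun _ _ => rfl
      ext D
      simp only [hbad, Finset.mem_filter, Finset.mem_powerset, Finset.subset_iff]
      constructor
      · rintro ⟨h, hk⟩
        exact ⟨fun r hr => (h hr).1, hk, fun r hr => (h hr).2⟩
      · rintro ⟨h, hk, h'⟩
        exact ⟨fun r hr => ⟨h hr, h' r hr⟩, hk⟩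
    rw [Finset.sum_congr rfl h3, Finset.sum_comm]
    refine Finset.sum_congr rfl fun D _ => ?_
    rw [← Finset.sum_filter, Finset.sum_const, nsmul_eq_mul, mul_comm]
  have h4 : ∀ D ∈ R.powerset.filter (fun D => D.card ≤ 2 * k), (-1 : ℝ) ^ D.card * cnt D ≤
      X * ((-1 : ℝ) ^ D.card * ∏ r ∈ D, ((Ω r).card : ℝ) / r) + ∏ r ∈ D, ((Ω r).card : ℝ) := by
    intro D hD
    have hDR := Finset.mem_powerset.mp (Finset.mem_filter.mp hD).1
    have h5 := abs_card_residues_sub_le a X Ω D 1 0 one_pos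
      (fun r hr => ⟨(hR r (hDR hr)).1, Nat.coprime_one_left r, (hR r (hDR hr)).2⟩)
      (hpw.mono (Finset.coe_subset.mpr hDR))
    simp only [Nat.modEq_one, true_and, Nat.cast_one, div_one] at h5
    have h6 : |cnt D - X * ∏ r ∈ D, ((Ω r).card : ℝ) / r| ≤ ∏ r ∈ D, ((Ω r).card : ℝ) := h5
    rw [abs_le] at h6
    rcases neg_one_pow_eq_or ℝ D.card with h | h <;> rw [h] <;> linarith [h6.1, h6.2]
  rw [h1]
  refine h2.trans ((Finset.sum_le_sum h4).trans ?_)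
  rw [Finset.sum_add_distrib, ← Finset.mul_sum]
  refine add_le_add (mul_le_mul_of_nonneg_left ?_ (Nat.cast_nonneg _)) ?_
  · exact sum_powerset_filter_card_alternating_le (fun r _ => by positivity) k
  · exact sum_powerset_filter_card_le_prod (fun r _ => by positivity) hW _

end BrunSieve

/-! ### Sieving dyadic blocks of primes -/

section ThinSets

open Real

/-- Sieve by all primes r < 2^I, removing the class 0 always and also γ r when r is in B. The class
0 is avoided since q is prime and q ≥ 2^j ≥ 2^I > r. -/
theorem card_block_le {B : Finset ℕ} {γ : ℕ → ℕ} {I j k : ℕ} (hI : 0 < I) (hIj : I ≤ j)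
    (hB : ∀ r ∈ B, r < 2 ^ I ∧ r.Prime ∧ 0 < γ r ∧ γ r < r) {Q : Finset ℕ}
    (hQ : ∀ q ∈ Q, q.Prime ∧ 2 ^ j ≤ q ∧ q < 2 ^ (j + 1) ∧ ∀ r ∈ B, q % r ≠ γ r) :
    (Q.card : ℝ) ≤ 2 ^ j * (2 / I * exp (-∑ r ∈ B, (1 : ℝ) / r) +
      (1 / 4) ^ k * exp (4 * (4 + 4 * log I))) + (2 ^ I) ^ (2 * k) * exp 2 := by
  set R := (Finset.range (2 ^ I)).filter Nat.Prime with hR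
  set Ω : ℕ → Finset ℕ := fun r => if r ∈ B then {0, γ r} else {0} with hΩ
  have hBR : B ⊆ R := fun r hr => by
    rw [hR, Finset.mem_filter, Finset.mem_range]; exact ⟨(hB r hr).1, (hB r hr).2.1⟩
  have hRp : ∀ r ∈ R, r.Prime := fun r hr => (Finset.mem_filter.mp hr).2
  have hcard2 : ∀ r, ((Ω r).card : ℝ) ≤ 2 := by
    intro r
    have : (Ω r).card ≤ 2 := by
      simp only [hΩ]; split_ifs
      · exact Finset.card_le_two
      · simp
    exact_mod_cast this
  have hcardB : ∀ r ∈ B, (Ω r).card = 2 := by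
    intro r hr
    simp only [hΩ, if_pos hr]
    exact Finset.card_pair (hB r hr).2.2.1.ne
  have hcardnB : ∀ r, r ∉ B → (Ω r).card = 1 := by
    intro r hr
    simp [hΩ, if_neg hr]
  have hsieve := card_avoiding_residues_le (2 ^ j) (2 ^ j) k R Ω
    (fun r hr => ⟨(hRp r hr).pos, fun c hc => by
      by_cases hrB : r ∈ B
      · simp only [hΩ, if_pos hrB, Finset.mem_insert, Finset.mem_singleton] at hc
        rcases hc with rfl | rfl
        · exact (hRp r hr).pos
        · exact (hB r hrB).2.2.2
      · simp only [hΩ, if_neg hrB, Finset.mem_singleton] at hc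
        rw [hc]; exact (hRp r hr).pos⟩)
    (fun r hr r' hr' hne => (Nat.coprime_primes (hRp r hr) (hRp r' hr')).mpr hne)
    (W := 2 ^ I) (one_le_pow₀ (by norm_num))
  have hQsub : Q ⊆ (Finset.Ico (2 ^ j) (2 ^ j + 2 ^ j)).filter fun m => ∀ r ∈ R, m % r ∉ Ω r := by
    intro q hq
    obtain ⟨hqp, hq1, hq2, hq3⟩ := hQ q hq
    rw [Finset.mem_filter, Finset.mem_Ico]
    refine ⟨⟨hq1, by rw [pow_succ] at hq2; omega⟩, fun r hr hmem => ?_⟩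
    have hrlt : r < q := lt_of_lt_of_le (Finset.mem_range.mp (Finset.mem_filter.mp hr).1)
      ((Nat.pow_le_pow_right (by norm_num) hIj).trans hq1)
    have hq0 : q % r ≠ 0 := by
      intro h0
      rcases (Nat.dvd_prime hqp).mp (Nat.dvd_of_mod_eq_zero h0) with h | h
      · exact (hRp r hr).one_lt.ne' h
      · omega
    by_cases hrB : r ∈ B
    · simp only [hΩ, if_pos hrB, Finset.mem_insert, Finset.mem_singleton] at hmem
      exact hmem.elim hq0 (hq3 r hrB)
    · simp only [hΩ, if_neg hrB, Finset.mem_singleton] at hmem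
      exact hq0 hmem
  have h1 : (Q.card : ℝ) ≤ _ := (Nat.cast_le.mpr (Finset.card_le_card hQsub)).trans hsieve
  rw [Nat.cast_pow, Nat.cast_ofNat] at h1
  refine h1.trans (add_le_add (mul_le_mul_of_nonneg_left (add_le_add ?_ ?_) (by positivity)) ?_)
  -- For r in B, 1 - 2/r ≤ (1 - 1/r) exp(-1/r): one factor gives the density of primes, the other
  -- the gain from B.
  · have h2 : ∏ r ∈ R, (1 - ((Ω r).card : ℝ) / r) ≤
        ∏ r ∈ R, ((1 - 1 / (r : ℝ)) * if r ∈ B then exp (-(1 / (r : ℝ))) else 1) := by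
      refine Finset.prod_le_prod (fun r hr => ?_) fun r hr => ?_
      · have : (2 : ℝ) ≤ r := by exact_mod_cast (hRp r hr).two_le
        rw [sub_nonneg, div_le_one (by linarith)]
        exact (hcard2 r).trans this
      · have hr2 : (2 : ℝ) ≤ r := by exact_mod_cast (hRp r hr).two_le
        by_cases hrB : r ∈ B
        · rw [if_pos hrB, hcardB r hrB]
          have h3 := add_one_le_exp (-(1 / (r : ℝ)))
          have h4 : (0 : ℝ) ≤ 1 - 1 / r := by
            rw [sub_nonneg, div_le_one (by linarith)]; linarith
          have h5 := mul_le_mul_of_nonneg_left h3 h4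
          have h6 : (0 : ℝ) ≤ 1 / r * (1 / r) := by positivity
          have h7 : ((2 : ℕ) : ℝ) / r = 1 / r + 1 / r := by push_cast; ring
          rw [h7]
          nlinarith
        · rw [if_neg hrB, hcardnB r hrB]; simp
    refine h2.trans ?_
    rw [Finset.prod_mul_distrib]
    refine mul_le_mul (prod_one_sub_inv_primes_lt_two_pow_le hI) (le_of_eq ?_)
      (Finset.prod_nonneg fun r _ => by split_ifs <;> positivity) (by positivity)
    rw [← Finset.sum_neg_distrib, exp_sum, ← Finset.prod_filter]
    congr 1
    ext r
    simp only [Finset.mem_filter]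
    exact ⟨fun h => h.2, fun h => ⟨hBR h, h⟩⟩
  · refine mul_le_mul_of_nonneg_left ?_ (by positivity)
    calc ∏ r ∈ R, (1 + 2 * (((Ω r).card : ℝ) / r)) ≤ ∏ r ∈ R, exp (4 * (1 / (r : ℝ))) := by
          refine Finset.prod_le_prod (fun r _ => by positivity) fun r _ => ?_
          have h3 := add_one_le_exp (4 * (1 / (r : ℝ)))
          have h4 : ((Ω r).card : ℝ) / r ≤ 2 / r :=
            div_le_div_of_nonneg_right (hcard2 r) (Nat.cast_nonneg r)
          have h5 : (2 : ℝ) / r = 2 * (1 / r) := by ring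
          linarith
      _ = exp (4 * ∑ r ∈ R, 1 / (r : ℝ)) := by rw [← exp_sum, Finset.mul_sum]
      _ ≤ _ := exp_le_exp.mpr
          (mul_le_mul_of_nonneg_left (sum_inv_primes_lt_two_pow_le hI) (by norm_num))
  · refine mul_le_mul_of_nonneg_left ?_ (by positivity)
    calc ∏ r ∈ R, (1 + ((Ω r).card : ℝ) / 2 ^ I) ≤ ∏ r ∈ R, exp (2 / 2 ^ I) := by
          refine Finset.prod_le_prod (fun r _ => by positivity) fun r _ => ?_
          have h3 := add_one_le_exp (2 / (2 : ℝ) ^ I)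
          have h4 : ((Ω r).card : ℝ) / 2 ^ I ≤ 2 / 2 ^ I :=
            div_le_div_of_nonneg_right (hcard2 r) (by positivity)
          linarith
      _ = exp (R.card * (2 / 2 ^ I)) := by
          rw [Finset.prod_const, ← exp_nat_mul]
      _ ≤ exp 2 := by
          refine exp_le_exp.mpr ?_
          have h3 : (R.card : ℝ) ≤ 2 ^ I := by
            have : R.card ≤ 2 ^ I := (Finset.card_filter_le _ _).trans (by simp)
            exact_mod_cast this
          rw [mul_div_assoc', div_le_iff₀ (by positivity)]
          linarith

/-- The level of the sieve used for primes `q` with `log₂ log₂ q` of integer part `h`. -/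
def sieveLevel (h : ℕ) : ℕ := 2 ^ h / (80 * (h + 1))

theorem eighty_mul_le_two_pow {h : ℕ} (hh : 11 ≤ h) : 80 * (h + 1) ≤ 2 ^ h := by
  induction h, hh using Nat.le_induction with
  | base => norm_num
  | succ h hh ih => rw [pow_succ]; omega

theorem sieveLevel_bounds {h : ℕ} (hh : 11 ≤ h) :
    0 < sieveLevel h ∧ 80 * (h + 1) * sieveLevel h ≤ 2 ^ h ∧
      2 ^ h ≤ 160 * (h + 1) * sieveLevel h := by
  have h0 := eighty_mul_le_two_pow hh
  have hpos : 0 < 80 * (h + 1) := by positivity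
  have h1 : 0 < sieveLevel h := Nat.div_pos h0 hpos
  have h2 : 80 * (h + 1) * sieveLevel h ≤ 2 ^ h := Nat.mul_div_le _ _
  have h3 : 2 ^ h < 80 * (h + 1) * (sieveLevel h + 1) := Nat.lt_mul_div_succ _ hpos
  refine ⟨h1, h2, ?_⟩
  nlinarith

/-- Multiplication by 2^h accounts for the 2^h dyadic blocks with the same h. The level and k =
10(h+1) are balanced so that both sieve errors are at most a constant times 2^(-h), below the main
term's bound. -/
theorem block_bound_le {c X : ℝ} (hc : 1 ≤ c) (hX : 0 ≤ X) {h : ℕ} (hh : 11 ≤ h) :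
    2 ^ h * ((2 / (sieveLevel h : ℝ) * exp (X - log (sieveLevel h) / c) +
      (1 / 4) ^ (10 * (h + 1)) * exp (4 * (4 + 4 * log (sieveLevel h)))) +
      (2 ^ sieveLevel h) ^ (2 * (10 * (h + 1))) * exp 2 / 2 ^ (2 ^ h)) ≤
    exp (X + 18) * (((h : ℝ) + 1) ^ 2 * exp (-(h * log 2 / c))) := by
  obtain ⟨hI0, hI1, hI2⟩ := sieveLevel_bounds hh
  set I := sieveLevel h with hI
  have hIpos : (0 : ℝ) < I := by exact_mod_cast hI0
  have hI2' : (2 : ℝ) ^ h ≤ 160 * (h + 1) * I := by exact_mod_cast hI2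
  have hlogI : log (I : ℝ) ≤ h * log 2 := by
    rw [← log_pow]
    refine log_le_log hIpos ?_
    have : I ≤ 2 ^ h := le_trans (Nat.le_mul_of_pos_left _ (by positivity)) hI1
    exact_mod_cast this
  have hlog2 : 0 < log 2 := log_pos (by norm_num)
  have hh1 : (1 : ℝ) ≤ h + 1 := by linarith [(Nat.cast_nonneg h : (0 : ℝ) ≤ h)]
  set y := exp (-(h * log 2 / c)) with hy
  have hypos : 0 < y := exp_pos _
  have hypow : (1 / 2 : ℝ) ^ h ≤ y := by
    have h1 : (1 / 2 : ℝ) ^ h = exp (-(h * log 2)) := by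
      rw [one_div, inv_pow, exp_neg, ← log_pow, exp_log (by positivity)]
    rw [h1, hy]
    refine exp_le_exp.mpr (neg_le_neg ?_)
    exact div_le_self (by positivity) hc
  have hsq : (1 : ℝ) ≤ ((h : ℝ) + 1) ^ 2 := one_le_pow₀ hh1
  have hfirst : 2 ^ h * (2 / (I : ℝ) * exp (X - log I / c)) ≤
      51200 * exp X * (((h : ℝ) + 1) ^ 2 * y) := by
    have h1 : 2 ^ h * (2 / (I : ℝ)) ≤ 320 * (h + 1) := by
      rw [mul_div_assoc', div_le_iff₀ hIpos]; linarith
    have h2 : exp (X - log I / c) ≤ exp X * (160 * (h + 1) * y) := by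
      rw [sub_eq_add_neg, exp_add]
      refine mul_le_mul_of_nonneg_left ?_ (exp_pos X).le
      have h3 : h * log 2 ≤ log (160 * (h + 1)) + log I := by
        rw [← log_mul (by positivity) hIpos.ne', ← log_pow]
        exact log_le_log (by positivity) hI2'
      have h4 : -(log I / c) ≤ log (160 * (h + 1)) + -(h * log 2 / c) := by
        have h5 : 0 ≤ log (160 * ((h : ℝ) + 1)) := log_nonneg (by linarith)
        have h6 : log (160 * ((h : ℝ) + 1)) / c ≤ log (160 * ((h : ℝ) + 1)) := div_le_self h5 hc
        have h7 : h * log 2 / c ≤ (log (160 * ((h : ℝ) + 1)) + log I) / c :=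
          div_le_div_of_nonneg_right h3 (by linarith)
        rw [add_div] at h7
        linarith
      refine (exp_le_exp.mpr h4).trans (le_of_eq ?_)
      rw [exp_add, exp_log (by positivity)]
    calc 2 ^ h * (2 / (I : ℝ) * exp (X - log I / c))
        = 2 ^ h * (2 / (I : ℝ)) * exp (X - log I / c) := by ring
      _ ≤ 320 * (h + 1) * (exp X * (160 * (h + 1) * y)) :=
          mul_le_mul h1 h2 (exp_pos _).le (by positivity)
      _ = _ := by ring
  have hsecond : 2 ^ h * ((1 / 4) ^ (10 * (h + 1)) * exp (4 * (4 + 4 * log I))) ≤ exp 16 * y := by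
    have h1 : exp (4 * (4 + 4 * log I)) ≤ exp 16 * 2 ^ (16 * h) := by
      rw [show 4 * (4 + 4 * log (I : ℝ)) = 16 + 16 * log I by ring, exp_add]
      refine mul_le_mul_of_nonneg_left ?_ (exp_pos _).le
      calc exp (16 * log I) ≤ exp (16 * (h * log 2)) := exp_le_exp.mpr (by linarith)
        _ = exp (log (2 ^ (16 * h))) := by rw [log_pow]; push_cast; ring_nf
        _ = 2 ^ (16 * h) := exp_log (by positivity)
    have h2 : (2 : ℝ) ^ h * ((1 / 4) ^ (10 * (h + 1)) * (exp 16 * 2 ^ (16 * h)))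
        ≤ exp 16 * (1 / 2) ^ h := by
      have h3 : ((1 : ℝ) / 4) ^ (10 * (h + 1)) ≤ (1 / 4) ^ (9 * h) :=
        pow_le_pow_of_le_one (by norm_num) (by norm_num) (by omega)
      have h4 : (2 : ℝ) ^ h * ((1 / 4) ^ (9 * h) * 2 ^ (16 * h)) = (1 / 2) ^ h := by
        rw [pow_mul, pow_mul, ← mul_pow, ← mul_pow]; norm_num
      calc (2 : ℝ) ^ h * ((1 / 4) ^ (10 * (h + 1)) * (exp 16 * 2 ^ (16 * h)))
          ≤ (2 : ℝ) ^ h * ((1 / 4) ^ (9 * h) * (exp 16 * 2 ^ (16 * h))) := by gcongr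
        _ = exp 16 * (2 ^ h * ((1 / 4) ^ (9 * h) * 2 ^ (16 * h))) := by ring
        _ ≤ _ := by rw [h4]
    refine le_trans ?_ (h2.trans (mul_le_mul_of_nonneg_left hypow (exp_pos _).le))
    gcongr
  have hthird : 2 ^ h * ((2 ^ I) ^ (2 * (10 * (h + 1))) * exp 2 / 2 ^ (2 ^ h)) ≤ exp 2 * y := by
    -- The level gives 20(h+1)I ≤ 2^h / 4; the second h leaves room for the factor 2^(-h).
    have h1 : h + I * (2 * (10 * (h + 1))) + h ≤ 2 ^ h := by
      have h2 := eighty_mul_le_two_pow hh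
      have h3 : 4 * (I * (2 * (10 * (h + 1)))) = 80 * (h + 1) * I := by ring
      omega
    have h4 : (2 : ℝ) ^ h * (2 ^ I) ^ (2 * (10 * (h + 1))) * 2 ^ h ≤ 2 ^ (2 ^ h) := by
      rw [← pow_mul, ← pow_add, ← pow_add]
      exact pow_le_pow_right₀ (by norm_num) h1
    calc (2 : ℝ) ^ h * ((2 ^ I) ^ (2 * (10 * (h + 1))) * exp 2 / 2 ^ (2 ^ h))
        = exp 2 * ((2 ^ h * (2 ^ I) ^ (2 * (10 * (h + 1)))) / 2 ^ (2 ^ h)) := by ring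
      _ ≤ exp 2 * (1 / 2) ^ h := by
          refine mul_le_mul_of_nonneg_left ?_ (exp_pos _).le
          rw [one_div, inv_pow, ← one_div, div_le_div_iff₀ (by positivity) (by positivity)]
          linarith
      _ ≤ _ := mul_le_mul_of_nonneg_left hypow (exp_pos _).le
  have hy' : y ≤ ((h : ℝ) + 1) ^ 2 * y := le_mul_of_one_le_left hypos.le hsq
  set z := ((h : ℝ) + 1) ^ 2 * y with hz
  have hz0 : 0 < z := by positivity
  have he2 : (2.7 : ℝ) ≤ exp 1 := by have := exp_one_gt_d9; linarith
  have heX : 1 ≤ exp X := one_le_exp hX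
  have he16 : exp 16 = exp 1 ^ 16 := by rw [← exp_nat_mul]; norm_num
  have he2' : exp 2 = exp 1 ^ 2 := by rw [← exp_nat_mul]; norm_num
  have he18 : exp (X + 18) = exp X * exp 1 ^ 18 := by
    rw [exp_add, ← exp_nat_mul]; norm_num
  -- The three errors have constants 51200 = 320 · 160, e^16 and e^2; this is why 18 appears in the
  -- exponent.
  have hnum : 51200 + exp 1 ^ 16 + exp 1 ^ 2 ≤ exp 1 ^ 18 := by
    have h1 : (2.7 : ℝ) ^ 16 ≤ exp 1 ^ 16 := pow_le_pow_left₀ (by norm_num) he2 _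
    have h2 : (2.7 : ℝ) ^ 2 ≤ exp 1 ^ 2 := pow_le_pow_left₀ (by norm_num) he2 _
    have h3 : exp 1 ^ 18 = exp 1 ^ 16 * exp 1 ^ 2 := by ring
    rw [h3]
    norm_num at h1 h2
    nlinarith
  have hfin : 51200 * exp X * z + exp 16 * z + exp 2 * z ≤ exp (X + 18) * z := by
    rw [he16, he2', he18, ← add_mul, ← add_mul]
    refine mul_le_mul_of_nonneg_right ?_ hz0.le
    have h1 : exp 1 ^ 16 + exp 1 ^ 2 ≤ exp X * (exp 1 ^ 16 + exp 1 ^ 2) :=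
      le_mul_of_one_le_left (by positivity) heX
    have h2 := mul_le_mul_of_nonneg_left hnum (exp_pos X).le
    linarith
  have h5 : exp 16 * y ≤ exp 16 * z := mul_le_mul_of_nonneg_left hy' (exp_pos _).le
  have h6 : exp 2 * y ≤ exp 2 * z := mul_le_mul_of_nonneg_left hy' (exp_pos _).le
  rw [mul_add, mul_add]
  linarith

/-- With u = 1/(8c), the decay is at least e^(-4uh). Half of it absorbs (h+1)^2, and a geometric
tail of ratio e^(-2u) remains. -/
theorem sum_sq_mul_exp_neg_le {c : ℝ} (hc : 1 ≤ c) (H M : ℕ) :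
    ∑ h ∈ Finset.Ico H M, (((h : ℝ) + 1) ^ 2 * exp (-(h * log 2 / c))) ≤
      2 ^ 11 * c ^ 3 * exp (-(H / (4 * c))) := by
  set u : ℝ := 1 / (8 * c) with hu
  have hupos : 0 < u := by positivity
  have hu1 : u ≤ 1 / 8 := by
    rw [hu]; exact one_div_le_one_div_of_le (by norm_num) (by linarith)
  have hcu : c = 1 / (8 * u) := by rw [hu]; field_simp
  have hterm : ∀ h ∈ Finset.Ico H M, ((h : ℝ) + 1) ^ 2 * exp (-(h * log 2 / c)) ≤
      64 * c ^ 2 * exp (2 * u) * exp (-(2 * u)) ^ h := by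
    intro h _
    have hh0 : (0 : ℝ) ≤ h := Nat.cast_nonneg h
    have h1 : ((h : ℝ) + 1) * u ≤ exp (((h : ℝ) + 1) * u) := by
      linarith [add_one_le_exp (((h : ℝ) + 1) * u)]
    have h2 : (((h : ℝ) + 1) * u) ^ 2 ≤ exp (2 * u * h + 2 * u) := by
      refine (pow_le_pow_left₀ (by positivity) h1 2).trans (le_of_eq ?_)
      rw [← exp_nat_mul]; push_cast; ring_nf
    have h3 : ((h : ℝ) + 1) ^ 2 ≤ 64 * c ^ 2 * exp (2 * u * h + 2 * u) := by
      have h4 : ((h : ℝ) + 1) ^ 2 = 64 * c ^ 2 * (((h : ℝ) + 1) * u) ^ 2 := by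
        rw [hcu]; field_simp; ring
      rw [h4]; exact mul_le_mul_of_nonneg_left h2 (by positivity)
    have h5 : exp (-(h * log 2 / c)) ≤ exp (-(4 * u * h)) := by
      refine exp_le_exp.mpr (neg_le_neg ?_)
      have : (1 / 2 : ℝ) ≤ log 2 := by have := log_two_gt_d9; linarith
      have h6 : h * log 2 / c = 8 * u * (h * log 2) := by rw [hu]; field_simp
      rw [h6]
      nlinarith [mul_nonneg hupos.le hh0]
    calc ((h : ℝ) + 1) ^ 2 * exp (-(h * log 2 / c))
        ≤ 64 * c ^ 2 * exp (2 * u * h + 2 * u) * exp (-(4 * u * h)) :=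
          mul_le_mul h3 h5 (exp_pos _).le (by positivity)
      _ = 64 * c ^ 2 * (exp (2 * u * h + 2 * u) * exp (-(4 * u * h))) := by ring
      _ = 64 * c ^ 2 * (exp (2 * u) * exp (-(2 * u)) ^ h) := by
          rw [← exp_nat_mul, ← exp_add, ← exp_add]; ring_nf
      _ = _ := by ring
  refine (Finset.sum_le_sum hterm).trans ?_
  rw [← Finset.mul_sum]
  have hlt : exp (-(2 * u)) < 1 := by rw [exp_lt_one_iff]; linarith
  have hgeom := geom_sum_Ico_le_of_lt_one (m := H) (n := M) (exp_pos (-(2 * u))).le hlt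
  have hden : u ≤ 1 - exp (-(2 * u)) := by
    have h1 : exp (-(2 * u)) ≤ 1 / (1 + 2 * u) := by
      rw [exp_neg, inv_eq_one_div]
      exact one_div_le_one_div_of_le (by linarith) (by linarith [add_one_le_exp (2 * u)])
    have h2 : 1 / (1 + 2 * u) ≤ 1 - u := by
      rw [div_le_iff₀ (by linarith)]; nlinarith
    linarith
  have he : exp (-(2 * u)) ^ H = exp (-(H / (4 * c))) := by
    rw [← exp_nat_mul, hu]; congr 1; field_simp; ring
  have h3 : ∑ h ∈ Finset.Ico H M, exp (-(2 * u)) ^ h ≤ 8 * c * exp (-(H / (4 * c))) := by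
    refine hgeom.trans ?_
    rw [he, div_le_iff₀ (by linarith)]
    have h4 : 8 * c * u = 1 := by rw [hu]; field_simp
    have h5 : exp (-(H / (4 * c))) = 8 * c * exp (-(H / (4 * c))) * u := by
      rw [mul_right_comm, h4, one_mul]
    conv_lhs => rw [h5]
    exact mul_le_mul_of_nonneg_left hden (by positivity)
  have h6 : exp (2 * u) ≤ 4 := by
    have h7 : exp (2 * u) ≤ exp 1 := exp_le_exp.mpr (by linarith)
    have := exp_one_lt_d9
    linarith
  calc 64 * c ^ 2 * exp (2 * u) * ∑ h ∈ Finset.Ico H M, exp (-(2 * u)) ^ h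
      ≤ 64 * c ^ 2 * 4 * (8 * c * exp (-(H / (4 * c)))) :=
        mul_le_mul (mul_le_mul_of_nonneg_left h6 (by positivity)) h3
          (Finset.sum_nonneg fun _ _ => by positivity) (by positivity)
    _ = _ := by ring

end ThinSets

/-! ### Tail of the reciprocal sum over primes avoiding residue classes -/

section ReciprocalSumOfThinSet

open Real

/-- Group the q by h, the integer part of log₂ log₂ q, and then by dyadic block. Each exceptional r
lowers the sum of 1/r by at most 1, so `exc` costs only the factor e^e. -/
theorem exists_sum_inv_le_of_avoiding : ∃ A : ℕ, ∀ L : ℕ, 0 < L → ∀ e H : ℕ, 11 ≤ H →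
    ∀ (Q exc : Finset ℕ) (γ : ℕ → ℕ), exc.card ≤ e →
    (∀ q ∈ Q, q.Prime ∧ 2 ^ 2 ^ H ≤ q) →
    (∀ r : ℕ, r.Prime → r ≡ 1 [MOD L] → r ∉ exc → 0 < γ r ∧ γ r < r ∧ ∀ q ∈ Q, q % r ≠ γ r) →
    ∑ q ∈ Q, (1 : ℝ) / q ≤ exp ((e : ℝ) + (3 * L + A : ℕ) + 18) *
      (2 ^ 11 * (densityDenominator L : ℝ) ^ 3 * exp (-(H / (4 * (densityDenominator L : ℝ))))) := by
  obtain ⟨A, hA⟩ := exists_log_div_sub_le_sum_inv_primes_modEq_one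
  refine ⟨A, fun L hL e H hH Q exc γ hexc hQ hγ => ?_⟩
  set c : ℝ := (densityDenominator L : ℝ) with hc
  have hc1 : 1 ≤ c := by
    have h1 := densityDenominator_ge hL
    have h2 : 1 ≤ L ^ 2 := Nat.one_le_pow _ _ hL
    rw [hc]; exact_mod_cast h2.trans h1
  set X : ℝ := (e : ℝ) + (3 * L + A : ℕ) with hX
  have hX0 : 0 ≤ X := by positivity
  set τ : ℕ → ℕ := fun q => Nat.log 2 (Nat.log 2 q) with hτ
  have hlogq : ∀ q ∈ Q, 2 ^ H ≤ Nat.log 2 q := fun q hq =>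
    Nat.le_log_of_pow_le (by norm_num) (hQ q hq).2
  have hτH : ∀ q ∈ Q, H ≤ τ q := fun q hq => Nat.le_log_of_pow_le (by norm_num) (hlogq q hq)
  obtain ⟨M, hM⟩ : ∃ M, ∀ q ∈ Q, τ q < M := by
    refine ⟨Q.sup τ + 1, fun q hq => Nat.lt_succ_of_le (Finset.le_sup (f := τ) hq)⟩
  have hblock : ∀ h, 11 ≤ h → ∑ q ∈ Q with τ q = h, (1 : ℝ) / q ≤
      exp (X + 18) * (((h : ℝ) + 1) ^ 2 * exp (-(h * log 2 / c))) := by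
    intro h hh
    refine le_trans ?_ (block_bound_le hc1 hX0 hh)
    obtain ⟨hI0, hI1, hI2⟩ := sieveLevel_bounds hh
    set I := sieveLevel h with hI
    set B := (Finset.range (2 ^ I)).filter (fun r => (r.Prime ∧ r ≡ 1 [MOD L]) ∧ r ∉ exc) with hB
    have hBsum : -∑ r ∈ B, (1 : ℝ) / r ≤ X - log I / c := by
      have h1 := hA L hL I hI0
      rw [← Finset.sum_filter_add_sum_filter_not _ (fun r => r ∉ exc), Finset.filter_filter] at h1
      have h2 : ∑ r ∈ ((Finset.range (2 ^ I)).filter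
          (fun r => r.Prime ∧ r ≡ 1 [MOD L])).filter (fun r => ¬r ∉ exc), (1 : ℝ) / r ≤ e := by
        have h3 : ∀ r ∈ ((Finset.range (2 ^ I)).filter
          (fun r => r.Prime ∧ r ≡ 1 [MOD L])).filter (fun r => ¬r ∉ exc), (1 : ℝ) / r ≤ 1 := by
          intro r hr
          simp only [Finset.mem_filter] at hr
          have : (1 : ℝ) ≤ r := by exact_mod_cast hr.1.2.1.one_le
          rw [div_le_one (by linarith)]; exact this
        refine (Finset.sum_le_card_nsmul _ _ _ h3).trans ?_
        rw [nsmul_eq_mul, mul_one, Nat.cast_le]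
        refine (Finset.card_le_card fun r hr => ?_).trans hexc
        simpa using (Finset.mem_filter.mp hr).2
      rw [hX]
      linarith
    have hmaps : ∀ q ∈ Q.filter (fun q => τ q = h),
        Nat.log 2 q ∈ Finset.Ico (2 ^ h) (2 ^ (h + 1)) := by
      intro q hq
      obtain ⟨hq, hqh⟩ := Finset.mem_filter.mp hq
      have h0 : Nat.log 2 q ≠ 0 := by
        have := hlogq q hq
        have h1 : 0 < 2 ^ H := by positivity
        omega
      rw [Finset.mem_Ico, ← hqh]
      exact ⟨Nat.pow_log_le_self 2 h0, Nat.lt_pow_succ_log_self (by norm_num) _⟩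
    rw [← Finset.sum_fiberwise_of_maps_to hmaps]
    have hj : ∀ j ∈ Finset.Ico (2 ^ h) (2 ^ (h + 1)),
        ∑ q ∈ Q.filter (fun q => τ q = h) with Nat.log 2 q = j, (1 : ℝ) / q ≤
        (2 / (I : ℝ) * exp (X - log I / c) +
          (1 / 4) ^ (10 * (h + 1)) * exp (4 * (4 + 4 * log I))) +
          (2 ^ I) ^ (2 * (10 * (h + 1))) * exp 2 / 2 ^ (2 ^ h) := by
      intro j hj
      rw [Finset.mem_Ico] at hj
      set Qj := (Q.filter (fun q => τ q = h)).filter (fun q => Nat.log 2 q = j) with hQj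
      have hQjQ : ∀ q ∈ Qj, q ∈ Q ∧ Nat.log 2 q = j := fun q hq => by
        simp only [hQj, Finset.mem_filter] at hq
        exact ⟨hq.1.1, hq.2⟩
      have hQjlow : ∀ q ∈ Qj, 2 ^ j ≤ q := fun q hq => by
        rw [← (hQjQ q hq).2]
        exact Nat.pow_log_le_self 2 (hQ q (hQjQ q hq).1).1.ne_zero
      have hIj : I ≤ j := by
        have : I ≤ 2 ^ h := le_trans (Nat.le_mul_of_pos_left _ (by positivity)) hI1
        omega
      have hcard := card_block_le (B := B) (γ := γ) (k := 10 * (h + 1)) hI0 hIj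
        (fun r hr => by
          simp only [hB, Finset.mem_filter, Finset.mem_range] at hr
          obtain ⟨h1, h2, h3⟩ := hγ r hr.2.1.1 hr.2.1.2 hr.2.2
          exact ⟨hr.1, hr.2.1.1, h1, h2⟩) (Q := Qj)
        (fun q hq => by
          refine ⟨(hQ q (hQjQ q hq).1).1, hQjlow q hq, ?_, fun r hr => ?_⟩
          · rw [← (hQjQ q hq).2]
            exact Nat.lt_pow_succ_log_self (by norm_num) _
          · simp only [hB, Finset.mem_filter, Finset.mem_range] at hr
            exact (hγ r hr.2.1.1 hr.2.1.2 hr.2.2).2.2 q (hQjQ q hq).1)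
      have hinv : ∀ q ∈ Qj, (1 : ℝ) / q ≤ 1 / 2 ^ j := fun q hq =>
        one_div_le_one_div_of_le (by positivity) (by exact_mod_cast hQjlow q hq)
      refine (Finset.sum_le_card_nsmul _ _ _ hinv).trans ?_
      rw [nsmul_eq_mul, mul_one_div, div_le_iff₀ (by positivity)]
      refine hcard.trans ?_
      rw [add_mul, mul_comm]
      refine add_le_add (mul_le_mul_of_nonneg_right ?_ (by positivity)) ?_
      · have := exp_le_exp.mpr hBsum
        gcongr
      · rw [div_mul_eq_mul_div, le_div_iff₀ (by positivity)]
        refine mul_le_mul_of_nonneg_left ?_ (by positivity)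
        exact pow_le_pow_right₀ (by norm_num) hj.1
    refine (Finset.sum_le_card_nsmul _ _ _ hj).trans (le_of_eq ?_)
    rw [nsmul_eq_mul, Nat.card_Ico, pow_succ, Nat.mul_two, Nat.add_sub_cancel, Nat.cast_pow,
      Nat.cast_ofNat]
  have hmapsτ : ∀ q ∈ Q, τ q ∈ Finset.Ico H M := fun q hq =>
    Finset.mem_Ico.mpr ⟨hτH q hq, hM q hq⟩
  rw [← Finset.sum_fiberwise_of_maps_to hmapsτ]
  refine (Finset.sum_le_sum fun h hh => hblock h (hH.trans (Finset.mem_Ico.mp hh).1)).trans ?_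
  rw [← Finset.mul_sum]
  exact mul_le_mul_of_nonneg_left (sum_sq_mul_exp_neg_le hc1 H M) (exp_pos _).le

end ReciprocalSumOfThinSet

/-! ### Abundancy and reciprocals of prime factors -/

section Abundancy

open ArithmeticFunction

variable {ι : Type*} [Fintype ι] {P a : ι → ℕ}

theorem sigma_one_prod_primes_pow (hP : ∀ i, (P i).Prime) (hinj : Function.Injective P) :
    sigma 1 (∏ i, P i ^ a i) = ∏ i, ∑ k ∈ Finset.range (a i + 1), P i ^ k := by
  rw [isMultiplicative_sigma.map_prod _ _ fun i _ j _ hij =>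
    Nat.Coprime.pow _ _ ((Nat.coprime_primes (hP i) (hP j)).mpr (hinj.ne hij))]
  exact Finset.prod_congr rfl fun i _ => sigma_one_apply_prime_pow (hP i)

theorem sum_range_pow_le_pow_mul {x : ℝ} (hx : 2 ≤ x) (m : ℕ) :
    ∑ k ∈ Finset.range (m + 1), x ^ k ≤ x ^ m * (1 + 2 / x) := by
  have hx0 : 0 < x := by linarith
  induction m with
  | zero => simp; positivity
  | succ m ih =>
    rw [Finset.sum_range_succ]
    have h1 : x ^ (m + 1) * (1 + 2 / x) = x ^ m * (x + 2) := by
      rw [pow_succ]; field_simp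
    have h2 : 1 + 2 / x ≤ 2 := by
      have : 2 / x ≤ 1 := (div_le_one hx0).mpr hx
      linarith
    have h3 := mul_le_mul_of_nonneg_left h2 (pow_pos hx0 m).le
    rw [h1, pow_succ]
    nlinarith [pow_pos hx0 m]

theorem sigma_one_prod_primes_pow_le (hP : ∀ i, (P i).Prime) (hinj : Function.Injective P) :
    ((sigma 1 (∏ i, P i ^ a i) : ℕ) : ℝ) ≤
      ((∏ i, P i ^ a i : ℕ) : ℝ) * Real.exp (2 * ∑ i, (1 : ℝ) / P i) := by
  rw [sigma_one_prod_primes_pow hP hinj, Finset.mul_sum, Real.exp_sum]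
  push_cast
  rw [← Finset.prod_mul_distrib]
  refine Finset.prod_le_prod (fun i _ => by positivity) fun i _ => ?_
  have h2 : (2 : ℝ) ≤ P i := by exact_mod_cast (hP i).two_le
  refine (sum_range_pow_le_pow_mul h2 (a i)).trans
    (mul_le_mul_of_nonneg_left ?_ (by positivity))
  have := Real.add_one_le_exp (2 * (1 / (P i : ℝ)))
  rw [mul_one_div] at this ⊢
  linarith

theorem mul_sigma_eq_of_abundancyIndex {N n d : ℕ} (hN : 0 < N) (hd : 0 < d)
    (h : abundancyIndex N = (n : ℚ) / d) : d * sigma 1 N = n * N := by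
  have hN' : (N : ℚ) ≠ 0 := by positivity
  have hd' : (d : ℚ) ≠ 0 := by positivity
  rw [abundancyIndex, div_eq_div_iff hN' hd'] at h
  have h' : sigma 1 N * d = n * N := by exact_mod_cast h
  rw [mul_comm, h']

/-- Let T be the sum of reciprocals. From σ(N) > N follows d ≤ n - 1, so n ≤ (n-1) e^(2T), and 1 -
2T ≤ e^(-2T) ≤ 1 - 1/n. -/
theorem inv_le_sum_inv_of_mul_sigma_eq (hP : ∀ i, (P i).Prime) (hinj : Function.Injective P)
    {n d : ℕ} (hn : 0 < n) (hN : 1 < ∏ i, P i ^ a i)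
    (h : d * sigma 1 (∏ i, P i ^ a i) = n * ∏ i, P i ^ a i) :
    1 / (4 * (n : ℝ)) ≤ ∑ i, (1 : ℝ) / P i := by
  have hle := sigma_one_prod_primes_pow_le (a := a) hP hinj
  set N := ∏ i, P i ^ a i
  have hσ : N + 1 ≤ sigma 1 N := by
    rw [sigma_one_apply, ← Finset.sum_pair (f := fun m => m) hN.ne']
    refine Finset.sum_le_sum_of_subset fun m hm => ?_
    rw [Finset.mem_insert, Finset.mem_singleton] at hm
    rw [Nat.mem_divisors]
    rcases hm with rfl | rfl
    · exact ⟨dvd_rfl, by omega⟩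
    · exact ⟨one_dvd _, by omega⟩
  have hdn : d < n := by
    by_contra hcon
    push Not at hcon
    have h1 : n * (N + 1) ≤ d * sigma 1 N := Nat.mul_le_mul hcon hσ
    rw [h] at h1
    nlinarith
  have hn' : (1 : ℝ) ≤ n := by exact_mod_cast hn
  have hN' : (0 : ℝ) < N := by positivity
  set E := Real.exp (2 * ∑ i, (1 : ℝ) / P i) with hE
  have hr : (d : ℝ) * (sigma 1 N : ℕ) = n * N := by exact_mod_cast h
  have hd1 : (d : ℝ) + 1 ≤ n := by exact_mod_cast hdn
  have h2 : (n : ℝ) ≤ d * E := by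
    refine le_of_mul_le_mul_right ?_ hN'
    rw [← hr]
    have := mul_le_mul_of_nonneg_left hle (Nat.cast_nonneg d : (0 : ℝ) ≤ d)
    linarith
  have hEpos : 0 < E := Real.exp_pos _
  have h3 : (n : ℝ) ≤ (n - 1) * E :=
    h2.trans (mul_le_mul_of_nonneg_right (by linarith) hEpos.le)
  have h4 : E⁻¹ ≤ 1 - 1 / n := by
    have h5 : 0 < (n : ℝ) - 1 := by
      by_contra hcon
      push Not at hcon
      nlinarith
    have h6 : (1 - 1 / (n : ℝ)) = (n - 1) / n := by field_simp
    rw [h6, inv_le_comm₀ hEpos (div_pos h5 (by linarith)), inv_div, div_le_iff₀ h5]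
    linarith
  have h8 : 1 - 2 * ∑ i, (1 : ℝ) / P i ≤ E⁻¹ := by
    rw [hE, ← Real.exp_neg]
    linarith [Real.add_one_le_exp (-(2 * ∑ i, (1 : ℝ) / P i))]
  have h9 : 1 / (4 * (n : ℝ)) ≤ 1 / n / 2 := by
    rw [div_div]; exact one_div_le_one_div_of_le (by linarith) (by linarith)
  linarith

theorem exists_eq_of_prime_dvd_prod_pow (hP : ∀ i, (P i).Prime) {r : ℕ} (hr : r.Prime)
    (h : r ∣ ∏ i, P i ^ a i) : ∃ i, r = P i := by
  obtain ⟨i, _, hi⟩ := hr.prime.exists_mem_finset_dvd h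
  exact ⟨i, (Nat.prime_dvd_prime_iff_eq hr (hP i)).mp (hr.dvd_of_dvd_pow hi)⟩

end Abundancy

/-! ### Residue classes forcing a prime to divide σ -/

section ExcludedClasses

/-- Cauchy's theorem gives a unit x of order l mod r. Then x ≠ 1 and x^(b+1) = 1, so the geometric
sum vanishes at x. -/
theorem exists_excluded_residue {r l b : ℕ} (hr : r.Prime) (hl : l.Prime) (hlr : l ∣ r - 1)
    (hlb : l ∣ b + 1) : ∃ g, 0 < g ∧ g < r ∧
      ∀ q, q % r = g → r ∣ ∑ k ∈ Finset.range (b + 1), q ^ k := by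
  have := Fact.mk hr
  have := Fact.mk hl
  obtain ⟨x, hx⟩ := exists_prime_orderOf_dvd_card (G := (ZMod r)ˣ) l (by rwa [ZMod.card_units])
  have hx0 : (x : ZMod r) ≠ 0 := x.ne_zero
  refine ⟨(x : ZMod r).val, Nat.pos_of_ne_zero (by rwa [Ne, ZMod.val_eq_zero]),
    ZMod.val_lt _, fun q hq => ?_⟩
  have hqx : (q : ZMod r) = x := by
    rw [← ZMod.natCast_zmod_val (x : ZMod r), ← hq, ZMod.natCast_mod]
  have hx1 : (x : ZMod r) ≠ 1 := by
    intro h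
    have : x = 1 := Units.ext h
    rw [this, orderOf_one] at hx
    exact hl.one_lt.ne hx
  have hpow : (x : ZMod r) ^ (b + 1) = 1 := by
    have : x ^ (b + 1) = 1 := orderOf_dvd_iff_pow_eq_one.mp (hx ▸ hlb)
    rw [← Units.val_pow_eq_pow_val, this, Units.val_one]
  rw [← ZMod.natCast_eq_zero_iff]
  push_cast
  rw [hqx]
  have := geom_sum_mul (x : ZMod r) (b + 1)
  rw [hpow, sub_self, mul_eq_zero] at this
  exact this.resolve_right (sub_ne_zero.mpr hx1)

theorem dvd_sum_range_pow_of_modEq_one {q l b : ℕ} (hq : q ≡ 1 [MOD l]) (hl : l ∣ b + 1) :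
    l ∣ ∑ k ∈ Finset.range (b + 1), q ^ k := by
  rw [← ZMod.natCast_eq_zero_iff] at hl ⊢
  have h1 : (q : ZMod l) = 1 := by
    have := (ZMod.natCast_eq_natCast_iff _ _ _).mpr hq
    simpa using this
  push_cast at hl ⊢
  rw [h1]
  simpa using hl

end ExcludedClasses

/-! ### The explicit bound and its computability -/

section Bound

/-- A common multiple of all the positive integers up to `2 * sup S + 1`. -/
def exponentModulus (S : Finset ℕ) : ℕ := (2 * S.sup id + 1).factorial

theorem minFac_dvd_exponentModulus {S : Finset ℕ} {b : ℕ} (hb : b ∈ S) :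
    (2 * b + 1).minFac ∣ exponentModulus S := by
  refine Nat.dvd_factorial (Nat.minFac_pos _) ((Nat.minFac_le (by omega)).trans ?_)
  have : b ≤ S.sup id := Finset.le_sup (f := id) hb
  omega

theorem card_le_exponentModulus (S : Finset ℕ) : S.card ≤ exponentModulus S := by
  have h1 : S ⊆ Finset.range (S.sup id + 1) := fun b hb =>
    Finset.mem_range.mpr (Nat.lt_succ_of_le (Finset.le_sup (f := id) hb))
  have h2 := Finset.card_le_card h1
  rw [Finset.card_range] at h2
  have h3 := Nat.self_le_factorial (2 * S.sup id + 1)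
  unfold exponentModulus
  omega

/-- A lower bound for the double logarithm of the smallest prime factor that suffices for a
contradiction; `A` is the absolute constant of the sieve estimate. -/
def doubleLogBound (A s n L : ℕ) : ℕ :=
  4 * densityDenominator L *
    ((2 * n + s) + (3 * L + A) + 18 + 3 * densityDenominator L + L + n + 16)

/-- An explicit bound for the smallest prime factor. -/
def smallestPrimeBound (A s n L : ℕ) : ℕ := 2 ^ 2 ^ doubleLogBound A s n L

theorem le_doubleLogBound (A s n : ℕ) {L : ℕ} (hL : 0 < L) :
    s + n + L + 11 ≤ doubleLogBound A s n L := by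
  have h1 : 1 ≤ densityDenominator L := (Nat.one_le_pow _ _ hL).trans (densityDenominator_ge hL)
  have h3 := Nat.mul_le_mul_right
    ((2 * n + s) + (3 * L + A) + 18 + 3 * densityDenominator L + L + n + 16)
    (show 1 ≤ 4 * densityDenominator L by omega)
  unfold doubleLogBound
  omega

theorem mul_lt_smallestPrimeBound (A s n : ℕ) {L : ℕ} (hL : 0 < L) :
    16 * n * s ≤ smallestPrimeBound A s n L ∧ L < smallestPrimeBound A s n L := by
  have h1 := le_doubleLogBound A s n hL
  have h2 : doubleLogBound A s n L < 2 ^ doubleLogBound A s n L := Nat.lt_two_pow_self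
  have h3 : 2 ^ (s + n + L + 4) ≤ smallestPrimeBound A s n L :=
    Nat.pow_le_pow_right (by norm_num) (by omega)
  have hs : s < 2 ^ s := Nat.lt_two_pow_self
  have hn : n < 2 ^ n := Nat.lt_two_pow_self
  have hL' : L < 2 ^ L := Nat.lt_two_pow_self
  have h4 : n * s ≤ 2 ^ n * 2 ^ s := Nat.mul_le_mul hn.le hs.le
  have h5 : 2 ^ (s + n + L + 4) = 16 * (2 ^ n * 2 ^ s) * 2 ^ L := by ring
  have h6 : 1 ≤ 2 ^ n * 2 ^ s := Nat.mul_pos (by positivity) (by positivity)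
  constructor <;> nlinarith

open Real in
theorem card_mul_exp_mul_le {A s n L m : ℕ} (hn : 0 < n) (hL : 0 < L) (hm : m ≤ L) :
    m * (exp (((2 * n + s : ℕ) : ℝ) + (3 * L + A : ℕ) + 18) *
      (2 ^ 11 * (densityDenominator L : ℝ) ^ 3 *
        exp (-(doubleLogBound A s n L / (4 * (densityDenominator L : ℝ)))))) ≤ 1 / (16 * n) := by
  have hc1 : 1 ≤ densityDenominator L :=
    (Nat.one_le_pow _ _ hL).trans (densityDenominator_ge hL)
  have hc0 : (0 : ℝ) < densityDenominator L := by exact_mod_cast hc1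
  set c : ℝ := (densityDenominator L : ℝ) with hc
  set x : ℝ := ((2 * n + s : ℕ) : ℝ) + (3 * L + A : ℕ) + 18 with hx
  -- The summands of `doubleLogBound` cancel in turn e^x, c^3, m ≤ L, n, and 16 · 2^11.
  have hE : (doubleLogBound A s n L : ℝ) / (4 * c) = x + 3 * c + L + n + 16 := by
    rw [div_eq_iff (by positivity), doubleLogBound, hx, hc]
    push_cast; ring
  have hself : ∀ y : ℝ, y ≤ exp y := fun y => by linarith [add_one_le_exp y]
  have h1 : (m : ℝ) ≤ exp L := le_trans (by exact_mod_cast hm) (hself L)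
  have h2 : c ^ 3 ≤ exp (3 * c) := by
    have := pow_le_pow_left₀ hc0.le (hself c) 3
    rwa [← exp_nat_mul] at this
  have h3 : (16 : ℝ) * 2 ^ 11 ≤ exp 16 := by
    have h4 : (2 : ℝ) ^ 16 ≤ exp 1 ^ 16 :=
      pow_le_pow_left₀ (by norm_num) (by linarith [add_one_le_exp (1 : ℝ)]) _
    rw [← exp_nat_mul] at h4
    norm_num at h4 ⊢
    linarith
  have hn0 : (0 : ℝ) < n := by exact_mod_cast hn
  rw [hE, le_div_iff₀ (by positivity)]
  calc (m : ℝ) * (exp x * (2 ^ 11 * c ^ 3 * exp (-(x + 3 * c + L + n + 16)))) * (16 * n)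
      = (m * n * c ^ 3 * (16 * 2 ^ 11)) * (exp x * exp (-(x + 3 * c + L + n + 16))) := by ring
    _ ≤ (exp L * exp n * exp (3 * c) * exp 16) * (exp x * exp (-(x + 3 * c + L + n + 16))) := by
        have := hself n
        gcongr
    _ = 1 := by
        simp only [← exp_add]
        rw [exp_eq_one_iff]; ring

-- The bound is primitive recursive in its inputs. The number A is fixed once and for all, so it
-- enters as a constant.
open Primrec in
theorem effectivelyComputable_smallestPrimeBound (A : ℕ) :
    EffectivelyComputable fun s n S => smallestPrimeBound A s n (exponentModulus S) := by
  have hpow : Primrec₂ ((· ^ ·) : ℕ → ℕ → ℕ) := Primrec₂.unpaired'.1 Nat.Primrec.pow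
  have hfact : Primrec Nat.factorial := by
    refine (Primrec.nat_rec₁ 1 (f := fun m ih => (m + 1) * ih)
      (nat_mul.comp (succ.comp Primrec.fst) Primrec.snd).to₂).of_eq fun m => ?_
    induction m with
    | zero => rfl
    | succ m ih => rw [Nat.factorial_succ, ← ih]
  have hsup : Primrec fun x : ℕ × ℕ × List ℕ => x.2.2.toFinset.sup id := by
    refine (list_foldr (g := fun _ => 0) (h := fun _ (b : ℕ × ℕ) => max b.1 b.2)
      (Primrec.snd.comp Primrec.snd) (Primrec.const 0)
      (nat_max.comp (Primrec.fst.comp Primrec.snd) (Primrec.snd.comp Primrec.snd)).to₂).of_eq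
      fun x => ?_
    induction x.2.2 with
    | nil => rfl
    | cons b l ih => rw [List.foldr_cons, ih, List.toFinset_cons, Finset.sup_insert]; rfl
  have hL : Primrec fun x : ℕ × ℕ × List ℕ => exponentModulus x.2.2.toFinset :=
    hfact.comp (succ.comp (nat_mul.comp (Primrec.const 2) hsup))
  have hc : Primrec fun x : ℕ × ℕ × List ℕ =>
      densityDenominator (exponentModulus x.2.2.toFinset) :=
    nat_mul.comp (nat_mul.comp (Primrec.const 2)
      (hpow.comp (nat_mul.comp (Primrec.const 8) hL) hL)) (hpow.comp hL (Primrec.const 2))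
  have hs : Primrec fun x : ℕ × ℕ × List ℕ => x.1 := Primrec.fst
  have hn : Primrec fun x : ℕ × ℕ × List ℕ => x.2.1 := Primrec.fst.comp Primrec.snd
  have hk : ∀ k : ℕ, Primrec fun _ : ℕ × ℕ × List ℕ => k := fun k => Primrec.const k
  have hH : Primrec fun x : ℕ × ℕ × List ℕ =>
      doubleLogBound A x.1 x.2.1 (exponentModulus x.2.2.toFinset) :=
    nat_mul.comp (nat_mul.comp (hk 4) hc) (nat_add.comp (nat_add.comp (nat_add.comp
      (nat_add.comp (nat_add.comp (nat_add.comp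
        (nat_add.comp (nat_mul.comp (hk 2) hn) hs)
        (nat_add.comp (nat_mul.comp (hk 3) hL) (hk A))) (hk 18))
        (nat_mul.comp (hk 3) hc)) hL) hn) (hk 16))
  exact (hpow.comp (hk 2) (hpow.comp (hk 2) hH)).to_comp

end Bound

/-! ### Consequences of the absence of small prime factors -/

section SmallestPrimeFactor

variable {s t n N : ℕ} {p : Fin s → ℕ} {q β : Fin t → ℕ}

/-- Each such j gives a prime l_j dividing the j-th factor of σ. As l_j ≤ L, it does not divide N,
so the product of the l_j divides n and 2^|J| ≤ n. -/
theorem card_modEq_one_le {L : ℕ} (hn : 0 < n) (hlL : ∀ j, (2 * β j + 1).minFac ∣ L)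
    (hL : 0 < L) (hβ : ∀ j, 0 < β j)
    (hlarge : ∀ r : ℕ, r.Prime → r ∣ N → L < r)
    (hσ : ∏ j, ∑ k ∈ Finset.range (2 * β j + 1), q j ^ k ∣ n * N) :
    (Finset.univ.filter fun j => q j ≡ 1 [MOD L]).card ≤ n := by
  set J := Finset.univ.filter fun j => q j ≡ 1 [MOD L] with hJ
  have hlp : ∀ j, (2 * β j + 1).minFac.Prime := fun j =>
    Nat.minFac_prime (by have := hβ j; omega)
  have h1 : ∏ j ∈ J, (2 * β j + 1).minFac ∣ n * N := by
    refine dvd_trans (Finset.prod_dvd_prod_of_dvd _ _ fun j hj => ?_)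
      ((Finset.prod_dvd_prod_of_subset _ _ _ (Finset.subset_univ J)).trans hσ)
    exact dvd_sum_range_pow_of_modEq_one
      ((Finset.mem_filter.mp hj).2.of_dvd (hlL j)) (Nat.minFac_dvd _)
  have h2 : Nat.Coprime (∏ j ∈ J, (2 * β j + 1).minFac) N := by
    refine Nat.Coprime.prod_left fun j _ => ?_
    rw [(hlp j).coprime_iff_not_dvd]
    intro hdvd
    exact absurd (Nat.le_of_dvd hL (hlL j)) (not_le.mpr (hlarge _ (hlp j) hdvd))
  have h3 := Nat.le_of_dvd hn (h2.dvd_of_dvd_mul_right h1)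
  have h4 : 2 ^ J.card ≤ ∏ j ∈ J, (2 * β j + 1).minFac :=
    Finset.pow_card_le_prod _ _ _ fun j _ => (hlp j).two_le
  exact (Nat.lt_two_pow_self.trans_le (h4.trans h3)).le

theorem exists_residues_avoided {L b : ℕ} {exc : Finset ℕ} (hb : 0 < b)
    (hbL : (2 * b + 1).minFac ∣ L)
    (hσ : ∀ j, ∑ k ∈ Finset.range (2 * β j + 1), q j ^ k ∣ n * N)
    (hexc : ∀ r : ℕ, r.Prime → r ≡ 1 [MOD L] → r ∣ n * N → r ∈ exc) :
    ∃ γ : ℕ → ℕ, ∀ r : ℕ, r.Prime → r ≡ 1 [MOD L] → r ∉ exc → 0 < γ r ∧ γ r < r ∧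
      ∀ m ∈ (Finset.univ.filter fun j => β j = b).image q, m % r ≠ γ r := by
  have hl : (2 * b + 1).minFac.Prime := Nat.minFac_prime (by omega)
  have hex : ∀ r : ℕ, ∃ g : ℕ, r.Prime → r ≡ 1 [MOD L] → r ∉ exc → 0 < g ∧ g < r ∧
      ∀ m ∈ (Finset.univ.filter fun j => β j = b).image q, m % r ≠ g := by
    intro r
    by_cases h : r.Prime ∧ r ≡ 1 [MOD L] ∧ r ∉ exc
    · obtain ⟨hr, hr1, hre⟩ := h
      have hLr : L ∣ r - 1 := (Nat.modEq_iff_dvd' hr.one_le).mp hr1.symm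
      obtain ⟨g, hg0, hgr, hg⟩ :=
        exists_excluded_residue hr hl (hbL.trans hLr) (Nat.minFac_dvd (2 * b + 1))
      refine ⟨g, fun _ _ _ => ⟨hg0, hgr, fun m hm hmg => hre ?_⟩⟩
      obtain ⟨j, hj, rfl⟩ := Finset.mem_image.mp hm
      have h1 := hσ j
      rw [(Finset.mem_filter.mp hj).2] at h1
      exact hexc r hr hr1 ((hg _ hmg).trans h1)
    · exact ⟨0, fun h1 h2 h3 => absurd ⟨h1, h2, h3⟩ h⟩
  choose γ hγ using hex
  exact ⟨γ, hγ⟩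

theorem card_exceptional_primes_le (hn : 0 < n) {J : Finset (Fin t)} (hJ : J.card ≤ n) :
    (n.primeFactors ∪ (Finset.univ.image p ∪ J.image q)).card ≤ 2 * n + s := by
  have h1 : n.primeFactors.card ≤ n := by
    have : n.primeFactors ⊆ Finset.Icc 1 n := fun r hr =>
      Finset.mem_Icc.mpr ⟨(Nat.prime_of_mem_primeFactors hr).one_le,
        Nat.le_of_dvd hn (Nat.dvd_of_mem_primeFactors hr)⟩
    simpa using Finset.card_le_card this
  have h2 : (Finset.univ.image p).card ≤ s := by
    simpa using Finset.card_image_le (s := (Finset.univ : Finset (Fin s))) (f := p)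
  have h3 : (J.image q).card ≤ n := Finset.card_image_le.trans hJ
  have h4 := Finset.card_union_le n.primeFactors (Finset.univ.image p ∪ J.image q)
  have h5 := Finset.card_union_le (Finset.univ.image p) (J.image q)
  omega

theorem sum_inv_eq_sum_fiberwise {S : Finset ℕ} (hq : Function.Injective q) (hβS : ∀ j, β j ∈ S) :
    ∑ j, (1 : ℝ) / q j =
      ∑ b ∈ S, ∑ m ∈ (Finset.univ.filter fun j => β j = b).image q, (1 : ℝ) / m := by
  rw [← Finset.sum_fiberwise_of_maps_to (g := β) (t := S) fun j _ => hβS j]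
  refine Finset.sum_congr rfl fun b _ => ?_
  rw [Finset.sum_image fun i _ j _ h => hq h]

end SmallestPrimeFactor

/-! ### The contradiction between the two bounds for the reciprocal sum -/

theorem theorem1 :
    ∃ C : ℕ → ℕ → Finset ℕ → ℕ, EffectivelyComputable C ∧
      ∀ (s n : ℕ) (S : Finset ℕ), 0 < n →
      ∀ (d : ℕ), 0 < d →
      ∀ (t : ℕ) (p α : Fin s → ℕ) (q β : Fin t → ℕ),
        (∀ i, (p i).Prime) → (∀ j, (q j).Prime) →
        Function.Injective p → Function.Injective q → (∀ i j, p i ≠ q j) →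
        (∀ i, 0 < α i) → (∀ j, 0 < β j) → (∀ j, β j ∈ S) →
      ∀ N : ℕ, N = (∏ i, p i ^ α i) * ∏ j, q j ^ (2 * β j) → 1 < N →
        abundancyIndex N = (n : ℚ) / (d : ℚ) →
        ∃ r : ℕ, r.Prime ∧ r ∣ N ∧ r < C s n S := by
  obtain ⟨A, hA⟩ := exists_sum_inv_le_of_avoiding
  refine ⟨_, effectivelyComputable_smallestPrimeBound A, ?_⟩
  intro s n S hn d hd t p α q β hp hq hpi hqi hpq hα hβ hβS N hN hN1 hab
  by_contra! hlarge
  set L := exponentModulus S with hLdef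
  have hL : 0 < L := Nat.factorial_pos _
  obtain ⟨hCs, hCL⟩ := mul_lt_smallestPrimeBound A s n hL
  set C := smallestPrimeBound A s n L with hC
  have hσN := mul_sigma_eq_of_abundancyIndex (by omega) hd hab
  set P : Fin s ⊕ Fin t → ℕ := Sum.elim p q with hPdef
  set a : Fin s ⊕ Fin t → ℕ := Sum.elim α fun j => 2 * β j with hadef
  have hNP : N = ∏ i, P i ^ a i := by
    rw [Fintype.prod_sum_type, hN]; rfl
  have hP : ∀ i, (P i).Prime := by rintro (i | j); exacts [hp i, hq j]
  have hPinj : Function.Injective P := hpi.sumElim hqi hpq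
  have hσprod : ∏ i, ∑ k ∈ Finset.range (a i + 1), P i ^ k ∣ n * N := by
    rw [← hσN, hNP, sigma_one_prod_primes_pow hP hPinj]
    exact dvd_mul_left _ _
  have hσq : ∏ j, ∑ k ∈ Finset.range (2 * β j + 1), q j ^ k ∣ n * N := by
    rw [Fintype.prod_sum_type] at hσprod
    exact (dvd_mul_left _ _).trans hσprod
  have hlL : ∀ j, (2 * β j + 1).minFac ∣ L := fun j => minFac_dvd_exponentModulus (hβS j)
  have hPN : ∀ i, P i ∣ N := by
    intro i
    rw [hNP]
    refine (dvd_pow_self _ ?_).trans (Finset.dvd_prod_of_mem _ (Finset.mem_univ i))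
    rcases i with i | j
    · exact (hα i).ne'
    · exact (Nat.mul_pos two_pos (hβ j)).ne'
  have hJ := card_modEq_one_le hn hlL hL hβ
    (fun r hr hrN => hCL.trans_le (hlarge r hr hrN)) hσq
  set J := Finset.univ.filter fun j => q j ≡ 1 [MOD L] with hJdef
  set exc := n.primeFactors ∪ (Finset.univ.image p ∪ J.image q) with hexcdef
  -- A prime r ≡ 1 mod L dividing nN divides n, or is some p_i, or is a q_j which is then itself 1
  -- mod L.
  have hexc : ∀ r : ℕ, r.Prime → r ≡ 1 [MOD L] → r ∣ n * N → r ∈ exc := by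
    intro r hr hr1 hrd
    rw [hexcdef, Finset.mem_union, Finset.mem_union]
    rcases hr.dvd_mul.mp hrd with h | h
    · exact Or.inl (Nat.mem_primeFactors.mpr ⟨hr, h, hn.ne'⟩)
    · rw [hNP] at h
      obtain ⟨i | j, hi⟩ := exists_eq_of_prime_dvd_prod_pow hP hr h
      · exact Or.inr (Or.inl (Finset.mem_image.mpr ⟨i, Finset.mem_univ i, hi.symm⟩))
      · refine Or.inr (Or.inr (Finset.mem_image.mpr ⟨j, ?_, hi.symm⟩))
        refine Finset.mem_filter.mpr ⟨Finset.mem_univ j, ?_⟩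
        rw [hi] at hr1
        exact hr1
  have hsum := inv_le_sum_inv_of_mul_sigma_eq hP hPinj hn (hNP ▸ hN1) (hNP ▸ hσN)
  rw [Fintype.sum_sum_type] at hsum
  have hn0 : (0 : ℝ) < n := by exact_mod_cast hn
  have hsump : ∑ i, (1 : ℝ) / P (Sum.inl i) ≤ 1 / (16 * n) := by
    have hC0 : (0 : ℝ) < C := by exact_mod_cast (Nat.zero_le L).trans_lt hCL
    have h1 : ∀ i ∈ (Finset.univ : Finset (Fin s)), (1 : ℝ) / P (Sum.inl i) ≤ 1 / C := by
      intro i _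
      refine one_div_le_one_div_of_le hC0 ?_
      exact_mod_cast hlarge _ (hP _) (hPN (Sum.inl i))
    refine (Finset.sum_le_card_nsmul _ _ _ h1).trans ?_
    rw [nsmul_eq_mul, Finset.card_univ, Fintype.card_fin, mul_one_div,
      div_le_div_iff₀ hC0 (by positivity)]
    have h2 : ((16 * n * s : ℕ) : ℝ) ≤ C := by exact_mod_cast hCs
    push_cast at h2
    linarith
  have hsumq : ∑ j, (1 : ℝ) / P (Sum.inr j) ≤ 1 / (16 * n) := by
    change ∑ j, (1 : ℝ) / q j ≤ _
    rw [sum_inv_eq_sum_fiberwise hqi hβS]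
    refine le_trans (Finset.sum_le_card_nsmul _ _ _ fun b hb => ?_)
      (le_trans (le_of_eq (nsmul_eq_mul _ _))
        (card_mul_exp_mul_le (s := s) (A := A) hn hL (card_le_exponentModulus S)))
    -- S may contain 0, but no β_j equals 0, so that fibre is empty.
    rcases Nat.eq_zero_or_pos b with rfl | hb0
    · rw [Finset.filter_false_of_mem fun j _ => (hβ j).ne', Finset.image_empty, Finset.sum_empty]
      positivity
    · obtain ⟨γ, hγ⟩ := exists_residues_avoided hb0 (minFac_dvd_exponentModulus hb)
        (fun j => (Finset.dvd_prod_of_mem _ (Finset.mem_univ j)).trans hσq) hexc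
      refine hA L hL (2 * n + s) (doubleLogBound A s n L) ?_ _ exc γ
        (card_exceptional_primes_le hn hJ) (fun m hm => ?_) hγ
      · have := le_doubleLogBound A s n hL
        omega
      · obtain ⟨j, _, rfl⟩ := Finset.mem_image.mp hm
        exact ⟨hq j, hlarge _ (hq j) (hPN (Sum.inr j))⟩
  have hlt : 1 / (16 * (n : ℝ)) + 1 / (16 * n) < 1 / (4 * n) := by
    have h1 : 1 / (16 * (n : ℝ)) + 1 / (16 * n) = 1 / (4 * n) * (1 / 2) := by field_simp; norm_num
    have h2 : 0 < 1 / (4 * (n : ℝ)) := by positivity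
    rw [h1]; linarith
  linarith
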